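/- Let $n\ge 1$ and let $\mathrm{conv}(\mathbb R^n)$ be the space of nonempty compact convex subsets of $\mathbb R^n$ with the Hausdorff metric. Identify $u\in\mathrm{conv}(\mathbb R^n)$ with its support function $h_u(p)=\sup_{x\in u}(x,p)$. Let $V[u]$ be the volume, $V[u_1,\dots,u_n]$ Minkowski's mixed volume, and $V_1[u,v]=V[u,\dots,u,v]$. Let $A$ be a linear operator on $\mathbb R^n$, put $\exp\{\mathcal A c\}u=e^{cA}u$, and let $\varphi:\mathbb R_+\to\mathbb R_+$ and $F:\mathbb R_+\times\mathrm{conv}(\mathbb R^n)\to\mathrm{conv}(\mathbb R^n)$ be locally Lipschitz. Let $G\subset\mathrm{conv}(\mathbb R^n)$ be closed with $\{0\}\in G$, and let $\mathfrak F$ be a global semiflow on $G$: for all $u\in G$ and $t,s\ge 0$ one has $\mathfrak F^t(u)\in G$, $\mathfrak F^0(u)=u$, $\mathfrak F^t(\mathfrak F^s(u))=\mathfrak F^{t+s}(u)$, and $\mathfrak F^t(u)$ is continuous in $t\ge0$ for fixed $u$ and continuous in $u\in G$ for fixed $t$. Suppose that $\mathfrak F^t(\{0\})=\{0\}$ for $t\ge0$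 and that, for each $u_0\in G$, $u(t)=\mathfrak F^t(u_0)$ satisfies for all $t\ge 0$ $$u(t)=\exp\Big\{\mathcal A\int_0^t\varphi(V[u(s)])\,ds\Big\}u_0+\int_0^t\exp\Big\{\mathcal A\int_s^t\varphi(V[u(\tau)])\,d\tau\Big\}F(V[u(s)],u(s))\,ds .$$ Let $k\ge 1$, $W_0=V$, and let $W_1,\dots,W_k:\mathrm{conv}(\mathbb R^n)\to\mathbb R$ be nonnegative on $G$ and differentiable along the orbits of $\mathfrak F$ in $G$, in the sense that for $u\in G$ the function $t\mapsto W_i[\mathfrak F^t(u)]$ is continuous on $[0,\infty)$ and has a right derivative $\frac{dW_i[\mathfrak F^t(u)]}{dt}\big|_{t=0}$ at $0$. Let $f_i:\mathbb R_+^{i+1}\to\mathbb R$ and $\psi_i:\mathbb R_+^{i}\to\mathbb R$ $(1\le i\le k)$ be continuous, and suppose that for all $u\in G$ $$nV_1[u,F(V[u],u)]\le\psi_1(V[u])\,W_1[u],$$ $$\frac{dW_i[\mathfrak F^t(u)]}{dt}\Big|_{t=0}\le f_i(V[u],W_1[u],\dots,W_i[u])+\psi_{i+1}(V[u],W_1[u],\dots,W_i[u])\,W_{i+1}[u],\quad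 1\le i\le k-1,$$ $$\frac{dW_k[\mathfrak F^t(u)]}{dt}\Big|_{t=0}\le f_k(V[u],W_1[u],\dots,W_k[u]).$$ Consider in the cone $\mathbb R_+^{k+1}$ the comparison system $$\xi_0'=\operatorname{tr}A\,\varphi(\xi_0)\xi_0+\psi_1(\xi_0)\xi_1,\qquad \xi_i'=f_i(\xi_0,\dots,\xi_i)+\psi_{i+1}(\xi_0,\dots,\xi_i)\xi_{i+1}\ (1\le i\le k-1),\qquad \xi_k'=f_k(\xi_0,\dots,\xi_k). \tag{$*$}$$ Suppose that its right-hand sides satisfy the Ważewski condition in $\mathbb R_+^{k+1}$ (the $i$-th one is nondecreasing in each $\xi_j$, $j\ne i$) and that $\xi=0$ is a solution. The zero solution of $(*)$ is called $\xi_0$-stable in $\mathbb R_+^{k+1}$ if for every $\varepsilon>0$ there is $\delta>0$ such that all solutions in the cone with $\xi_i(0)>0$ for all $i$ and $\max_i\xi_i(0)<\delta$ exist for all $t\ge0$ (every such solution on a bounded interval $[0,T)$ extends to a solution on $[0,\infty)$) and satisfy $\xi_0(t)<\varepsilon$ for all $t\ge 0$. It is called asymptotically $\xi_0$-stable if, moreover,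 there is $\rho>0$ such that $\xi_0(t)\to0$ as $t\to+\infty$ for all such solutions on $[0,\infty)$ with $\max_i\xi_i(0)<\rho$. Let $h_0[u]=\max_{0\le i\le k}W_i[u]$. (1) If the zero solution of $(*)$ is $\xi_0$-stable in $\mathbb R_+^{k+1}$, then $\mathfrak F$ is stable in the measures $(h_0,V)$: for every $\varepsilon>0$ there is $\delta>0$ such that, for $u\in G$, $h_0[u]<\delta$ implies $V[\mathfrak F^t(u)]<\varepsilon$ for all $t\ge0$. (2) If the zero solution of $(*)$ is asymptotically $\xi_0$-stable in $\mathbb R_+^{k+1}$, then $\mathfrak F$ is asymptotically stable in the measures $(h_0,V)$: it is stable as in (1), and there is $\rho>0$ such that, for $u\in G$, $h_0[u]<\rho$ implies $V[\mathfrak F^t(u)]\to0$ as $t\to+\infty$. -/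

import Mathlib

open Set Filter Topology MeasureTheory

namespace ConvSemiflow

/-- The metric space `conv(ℝⁿ)` of nonempty compact convex subsets of `ℝⁿ`, with Minkowski addition,
multiplication by scalars and the Hausdorff metric (all of these are Mathlib's). -/
abbrev Conv (n : ℕ) : Type := ConvexBody (EuclideanSpace ℝ (Fin n))

/-- The volume `V[u]`. -/
noncomputable def vol {n : ℕ} (u : Conv n) : ℝ :=
  (volume (u : Set (EuclideanSpace ℝ (Fin n)))).toReal

/-- Minkowski's mixed volume `V[u₁, …, uₙ]`, that is, the symmetric coefficients in
`V[∑ λₖ uₖ] = ∑ V[u_{k₁}, …, u_{kₙ}] λ_{k₁} ⋯ λ_{kₙ}`, written out by polarization: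
`n! V[u₁, …, uₙ] = ∑_S (-1)^(n - |S|) V[∑_{i ∈ S} uᵢ]`, over all subsets `S` of `{1, …, n}`. -/
noncomputable def mixedVolume {n : ℕ} (u : Fin n → Conv n) : ℝ :=
  ((n.factorial : ℝ))⁻¹ * ∑ S : Finset (Fin n), (-1 : ℝ) ^ (n - S.card) * vol (∑ i ∈ S, u i)

/-- `V_m[u, v] = V[u, …, u, v, …, v]`, with `v` in the last `m` of the `n` places. -/
noncomputable def mixedVol {n : ℕ} (m : ℕ) (u v : Conv n) : ℝ :=
  mixedVolume (fun i : Fin n => if (i : ℕ) + m < n then u else v)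

/-- The support function `h_u(p) = sup_{x ∈ u} (x, p)`. -/
noncomputable def supp {n : ℕ} (u : Conv n) (p : EuclideanSpace ℝ (Fin n)) : ℝ :=
  sSup ((fun x : EuclideanSpace ℝ (Fin n) => inner ℝ x p) '' (u : Set (EuclideanSpace ℝ (Fin n))))

/-- The image of a convex compact under a linear map. -/
def linImage {n : ℕ} (L : EuclideanSpace ℝ (Fin n) →L[ℝ] EuclideanSpace ℝ (Fin n))
    (u : Conv n) : Conv n where
  carrier := L '' (u : Set (EuclideanSpace ℝ (Fin n)))
  convex' := u.convex.linear_image L.toLinearMap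
  isCompact' := u.isCompact.image L.continuous
  nonempty' := u.nonempty.image L

/-- The semiflow `exp{𝒜 c} u = e^{cA} u` on `conv(ℝⁿ)`. -/
noncomputable def expFlow {n : ℕ} (A : EuclideanSpace ℝ (Fin n) →L[ℝ] EuclideanSpace ℝ (Fin n))
    (c : ℝ) (u : Conv n) : Conv n :=
  linImage (NormedSpace.exp (c • A)) u

/-- `u : [0, ∞) → conv(ℝⁿ)` is a continuous solution, with initial value `u₀`, of
`u(t) = exp{𝒜 ∫₀ᵗ φ(V[u(s)]) ds} u₀ + ∫₀ᵗ exp{𝒜 ∫ₛᵗ φ(V[u(τ)]) dτ} F(V[u(s)], u(s)) ds`.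
Convex compacts are identified with their support functions, and the equation is one between
continuous functions of `p`; the integrand is continuous in `s`. -/
def SolvesIntegralEq {n : ℕ} (A : EuclideanSpace ℝ (Fin n) →L[ℝ] EuclideanSpace ℝ (Fin n))
    (φ : ℝ → ℝ) (F : ℝ → Conv n → Conv n) (u₀ : Conv n) (u : ℝ → Conv n) : Prop :=
  ContinuousOn u (Ici 0) ∧
  ∀ t : ℝ, 0 ≤ t → ∀ p : EuclideanSpace ℝ (Fin n),
    supp (u t) p =
      supp (expFlow A (∫ s in (0 : ℝ)..t, φ (vol (u s))) u₀) p +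
      ∫ s in (0 : ℝ)..t,
        supp (expFlow A (∫ τ in s..t, φ (vol (u τ))) (F (vol (u s)) (u s))) p

/-- `Φ` (with `Φ t u` for `𝔉ᵗ(u)`) is a global semiflow on the subset `G` of a metric space. -/
structure IsGlobalSemiflowOn {X : Type*} [MetricSpace X] (G : Set X) (Φ : ℝ → X → X) : Prop where
  mapsTo : ∀ t : ℝ, 0 ≤ t → ∀ u ∈ G, Φ t u ∈ G
  zero : ∀ u ∈ G, Φ 0 u = u
  add : ∀ t₁ t₂ : ℝ, 0 ≤ t₁ → 0 ≤ t₂ → ∀ u ∈ G, Φ t₁ (Φ t₂ u) = Φ (t₁ + t₂) u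
  continuous_time : ∀ u ∈ G, ContinuousOn (fun t => Φ t u) (Ici 0)
  continuous_space : ∀ t : ℝ, 0 ≤ t → ContinuousOn (Φ t) G

/-- `(h₀, h)`-stability of the semiflow `Φ` on `G`. -/
def StableInMeasures {X : Type*} (G : Set X) (Φ : ℝ → X → X) (h₀ h : X → ℝ) : Prop :=
  ∀ ε : ℝ, 0 < ε → ∃ δ : ℝ, 0 < δ ∧ ∀ u ∈ G, h₀ u < δ → ∀ t : ℝ, 0 ≤ t → h (Φ t u) < ε

/-- Asymptotic `(h₀, h)`-stability of the semiflow `Φ` on `G`. -/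
def AsympStableInMeasures {X : Type*} (G : Set X) (Φ : ℝ → X → X) (h₀ h : X → ℝ) : Prop :=
  StableInMeasures G Φ h₀ h ∧
  ∃ ρ : ℝ, 0 < ρ ∧ ∀ u ∈ G, h₀ u < ρ → Tendsto (fun t => h (Φ t u)) atTop (𝓝 0)

/-- The derivative `dW[𝔉ᵗ(u)]/dt` at `t = 0` (from the right). -/
noncomputable def orbitDeriv {X : Type*} (Φ : ℝ → X → X) (W : X → ℝ) (u : X) : ℝ :=
  derivWithin (fun t => W (Φ t u)) (Ici 0) 0

/-- `W` is differentiable along the orbits of the semiflow `Φ` on `G`: along each orbit it is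
continuous in time, and the right derivative at time `0` exists (so, by the semigroup property, the
right derivative exists at all times). -/
def DifferentiableAlongOrbits {X : Type*} (G : Set X) (Φ : ℝ → X → X) (W : X → ℝ) : Prop :=
  ∀ u ∈ G, ContinuousOn (fun t => W (Φ t u)) (Ici 0) ∧
    DifferentiableWithinAt ℝ (fun t => W (Φ t u)) (Ici 0) 0

/-- The cone `ℝ₊^m`. -/
def cone (m : ℕ) : Set (Fin m → ℝ) := {x | ∀ i, 0 ≤ x i}

/-- The initial segment `(ξ₀, …, ξᵢ)` of `ξ = (ξ₀, …, ξₖ)`. -/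
def initSeg {k : ℕ} (ξ : Fin (k + 1) → ℝ) (i : Fin (k + 1)) : Fin ((i : ℕ) + 1) → ℝ :=
  fun j => ξ ⟨(j : ℕ), by omega⟩

/-- The right-hand sides of the comparison system (for `k ≥ 1`, with `a = tr A`)
* `ξ₀' = a φ(ξ₀) ξ₀ + ψ₁(ξ₀) ξ₁`,
* `ξᵢ' = fᵢ(ξ₀, …, ξᵢ) + ψᵢ₊₁(ξ₀, …, ξᵢ) ξᵢ₊₁` for `1 ≤ i ≤ k - 1`,
* `ξₖ' = fₖ(ξ₀, …, ξₖ)`.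
Only `f₁, …, fₖ` and `ψ₁, …, ψₖ` occur. -/
noncomputable def compRHS (k : ℕ) (a : ℝ) (φ : ℝ → ℝ) (f : (i : ℕ) → (Fin (i + 1) → ℝ) → ℝ)
    (ψ : (i : ℕ) → (Fin i → ℝ) → ℝ) (ξ : Fin (k + 1) → ℝ) (i : Fin (k + 1)) : ℝ :=
  (if i = 0 then a * φ (ξ 0) * ξ 0 else f i (initSeg ξ i)) +
  (if h : (i : ℕ) < k then
    ψ ((i : ℕ) + 1) (initSeg ξ i) * ξ ⟨(i : ℕ) + 1, Nat.succ_lt_succ h⟩ else 0)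

/-- The Ważewski condition on the cone: the `i`-th right-hand side is nondecreasing in each `ξⱼ`,
`j ≠ i`. -/
def Wazewski {m : ℕ} (g : (Fin m → ℝ) → Fin m → ℝ) : Prop :=
  ∀ i : Fin m, ∀ x ∈ cone m, ∀ y ∈ cone m, x ≤ y → x i = y i → g x i ≤ g y i

/-- `ξ` is a solution of `ξ' = g(ξ)` in the cone on the time interval `I` (one-sided derivatives at
end points that belong to `I`). -/
def IsSolutionOn {m : ℕ} (g : (Fin m → ℝ) → Fin m → ℝ) (I : Set ℝ) (ξ : ℝ → Fin m → ℝ) : Prop :=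
  ∀ t ∈ I, ξ t ∈ cone m ∧ HasDerivWithinAt ξ (g (ξ t)) I t

/-- The zero solution of `ξ' = g(ξ)` is `ξ₀`-stable in the cone: for every `ε > 0` there is `δ > 0`
such that the solutions with `ξ(0) > 0` (in each component) and `‖ξ(0)‖_∞ < δ` exist for all
`t ≥ 0` (that is, each solution on a bounded interval `[0, T)` extends to `[0, ∞)`) and satisfy
`ξ₀(t) < ε` for all `t ≥ 0`. -/
def XiZeroStable {k : ℕ} (g : (Fin (k + 1) → ℝ) → Fin (k + 1) → ℝ) : Prop :=
  ∀ ε : ℝ, 0 < ε → ∃ δ : ℝ, 0 < δ ∧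
    (∀ (T : ℝ) (ξ : ℝ → Fin (k + 1) → ℝ), 0 < T → IsSolutionOn g (Ico 0 T) ξ →
      (∀ i, 0 < ξ 0 i) → ‖ξ 0‖ < δ →
        ∃ η : ℝ → Fin (k + 1) → ℝ, IsSolutionOn g (Ici 0) η ∧ EqOn η ξ (Ico 0 T)) ∧
    (∀ ξ : ℝ → Fin (k + 1) → ℝ, IsSolutionOn g (Ici 0) ξ →
      (∀ i, 0 < ξ 0 i) → ‖ξ 0‖ < δ → ∀ t : ℝ, 0 ≤ t → ξ t 0 < ε)

/-- The zero solution of `ξ' = g(ξ)` is asymptotically `ξ₀`-stable in the cone. -/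
def AsympXiZeroStable {k : ℕ} (g : (Fin (k + 1) → ℝ) → Fin (k + 1) → ℝ) : Prop :=
  XiZeroStable g ∧
  ∃ ρ : ℝ, 0 < ρ ∧ ∀ ξ : ℝ → Fin (k + 1) → ℝ, IsSolutionOn g (Ici 0) ξ →
    (∀ i, 0 < ξ 0 i) → ‖ξ 0‖ < ρ → Tendsto (fun t => ξ t 0) atTop (𝓝 0)

/-- The measure of initial deviations `h₀[u] = max_{0 ≤ i ≤ k} Wᵢ[u]`. -/
noncomputable def maxMeasure {X : Type*} (k : ℕ) (W : ℕ → X → ℝ) (u : X) : ℝ :=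
  (Finset.univ : Finset (Fin (k + 1))).sup' Finset.univ_nonempty (fun i => W i u)

end ConvSemiflow

open ConvSemiflow

/-! Along an orbit the vector (V, W₁, …, W_k) is a subsolution of the comparison system in the sense
of upper right derivatives. The Ważewski condition places it below a solution with slightly larger,
positive initial values, and the ξ₀-component of that solution bounds V. For Wᵢ, i ≥ 1, the
inequality is assumed at time 0 and carried to later times by the semigroup property. The work lies
in the inequality for V and in a comparison theorem for a right-hand side that is merely continuous.

Volume. Support functions show that, for small h, u(h) is contained in e^{c(h)A}(u₀ + h(F₀ + εB)),
where c(h) = ∫₀ʰ φ, F₀ = F(V[u₀], u₀) and B is the unit ball (`eventually_slope_vol_lt`). The trace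
term comes from det e^{cA}, the rest from the derivative of h ↦ V[u₀ + hw] at 0, and ε is removed by
continuity. That derivative rests on Minkowski's theorem for two bodies: if ν, ν' are finite
measures with full support on K, L, the gradient of log Z_ν + h log Z_ν' (Z the Laplace transform)
is injective and fills K + hL up to a null set. Its Jacobian det(Cov_ν + h Cov_ν') is polynomial in
h, hence so is the volume (`measureReal_add_smul_eq_sum`). The polarization sum for V₁ is a finite
difference that extracts the linear coefficient.

Comparison. Without uniqueness, Peano's theorem is applied to x' = g(w ⊔ x), w the subsolution. The
solution cannot fall below w, so the truncation is inactive. Zorn's lemma extends it, and the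
extension clause of ξ₀-stability excludes a bounded maximal interval
(`IsSubsolution.exists_solution_ge`). -/

namespace ConvSemiflow

set_option linter.unusedSectionVars false

/-! ### Logarithmic Laplace transforms of measures on a compact set -/

section LogLaplace

variable {E : Type*} [NormedAddCommGroup E] [InnerProductSpace ℝ E] [FiniteDimensional ℝ E]
  [MeasurableSpace E] [BorelSpace E]

/-- The measure `ν` lives on `K` and charges every ball centred at a point of `K`. -/
structure HasFullSupport (ν : Measure E) (K : Set E) : Prop where
  null : ν Kᶜ = 0
  pos : ∀ x ∈ K, ∀ r : ℝ, 0 < r → 0 < ν (Metric.ball x r)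

/-- Point masses 2⁻ⁱ at a dense sequence of K. Lebesgue measure would not do, since K may have empty
interior. -/
lemma exists_hasFullSupport {K : Set E} (hne : K.Nonempty) :
    ∃ ν : Measure E, IsFiniteMeasure ν ∧ HasFullSupport ν K := by
  have : Nonempty K := hne.to_subtype
  let d : ℕ → E := fun i => (TopologicalSpace.denseSeq K i : K)
  let ν : Measure E := Measure.sum fun i : ℕ => ((2 : ENNReal)⁻¹ ^ i) • Measure.dirac (d i)
  refine ⟨ν, ⟨?_⟩, ?_, ?_⟩
  · simp only [ν, Measure.sum_apply _ MeasurableSet.univ, Measure.smul_apply, measure_univ,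
      smul_eq_mul, mul_one]
    rw [ENNReal.tsum_geometric]
    simp
  · simp only [ν]
    rw [Measure.sum_apply_of_countable]
    refine ENNReal.tsum_eq_zero.2 fun i => ?_
    have hdi : d i ∈ K := (TopologicalSpace.denseSeq K i : K).2
    have : Measure.dirac (d i) Kᶜ = 0 := by
      rw [Measure.dirac_apply]
      simp [hdi]
    simp [this]
  · intro x hx r hr
    obtain ⟨i, hi⟩ := (TopologicalSpace.denseRange_denseSeq K).exists_dist_lt ⟨x, hx⟩ hr
    have h1 : (((2 : ENNReal)⁻¹ ^ i) • Measure.dirac (d i)) (Metric.ball x r) ≤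
        ν (Metric.ball x r) := by
      simp only [ν]
      rw [Measure.sum_apply _ Metric.isOpen_ball.measurableSet]
      exact ENNReal.le_tsum (f := fun i =>
        (((2 : ENNReal)⁻¹ ^ i) • Measure.dirac (d i)) (Metric.ball x r)) i
    refine lt_of_lt_of_le ?_ h1
    have h2 : d i ∈ Metric.ball x r := by
      rw [Metric.mem_ball, dist_comm]; exact hi
    rw [Measure.smul_apply, Measure.dirac_apply' _ Metric.isOpen_ball.measurableSet]
    simpa [h2] using ENNReal.pow_pos (by simp) i

variable {ν : Measure E} {K : Set E}

lemma integrable_of_continuous_of_null [IsFiniteMeasure ν] {F : Type*} [NormedAddCommGroup F]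
    (hK : IsCompact K) (hν : ν Kᶜ = 0) {g : E → F} (hg : Continuous g) : Integrable g ν := by
  have h : ν.restrict K = ν := 
    Measure.restrict_eq_self_of_ae_mem (mem_ae_iff.2 hν)
  rw [← h]
  exact hg.continuousOn.integrableOn_compact hK

/-- The exponential moment `p ↦ ∫ e^{(x, p)} g(x) dν(x)`. -/
noncomputable def expMoment {F : Type*} [NormedAddCommGroup F] [NormedSpace ℝ F] (ν : Measure E)
    (g : E → F) (p : E) : F :=
  ∫ x, Real.exp (inner ℝ x p) • g x ∂ν

lemma continuous_smulRight_innerSL {F : Type*} [NormedAddCommGroup F] [NormedSpace ℝ F]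
    {g : E → F} (hg : Continuous g) : Continuous fun x => (innerSL ℝ x).smulRight (g x) :=
  ((ContinuousLinearMap.smulRightL ℝ E F).continuous.comp (innerSL ℝ (E := E)).continuous).clm_apply
    hg

lemma hasFDerivAt_expMoment [IsFiniteMeasure ν] {F : Type*} [NormedAddCommGroup F]
    [NormedSpace ℝ F] (hK : IsCompact K) (hν : ν Kᶜ = 0) {g : E → F} (hg : Continuous g) (p : E) :
    HasFDerivAt (expMoment ν g)
      (expMoment ν (fun x => (innerSL ℝ x).smulRight (g x)) p) p := by
  obtain ⟨R, hR⟩ := hK.isBounded.exists_norm_le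
  obtain ⟨C, hC⟩ := (hK.image hg).isBounded.exists_norm_le
  refine hasFDerivAt_integral_of_dominated_of_fderiv_le (𝕜 := ℝ) (μ := ν)
    (F := fun q x => Real.exp (inner ℝ x q) • g x)
    (F' := fun q x => Real.exp (inner ℝ x q) • (innerSL ℝ x).smulRight (g x))
    (s := Metric.ball p 1)
    -- For x in K and q in the unit ball about p, (x, q) ≤ |R|(‖p‖ + 1).
    (bound := fun _ => Real.exp (|R| * (‖p‖ + 1)) * (|R| * |C|)) (Metric.ball_mem_nhds p one_pos)
    ?_ ?_ ?_ ?_ (integrable_const _) ?_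
  · exact Eventually.of_forall fun q => (integrable_of_continuous_of_null hK hν
      (g := fun x : E => Real.exp (inner ℝ x q) • g x) (by fun_prop)).aestronglyMeasurable
  · exact integrable_of_continuous_of_null hK hν (by fun_prop)
  · exact (integrable_of_continuous_of_null hK hν (by fun_prop)).aestronglyMeasurable
  · have : ∀ᵐ x ∂ν, x ∈ K := mem_ae_iff.2 hν
    filter_upwards [this] with x hx q hq
    have hxR : ‖x‖ ≤ |R| := (hR x hx).trans (le_abs_self R)
    have hgC : ‖g x‖ ≤ |C| := (hC _ (mem_image_of_mem g hx)).trans (le_abs_self C)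
    have hqn : ‖q‖ ≤ ‖p‖ + 1 := by
      have := norm_sub_norm_le q p
      rw [Metric.mem_ball, dist_eq_norm] at hq
      linarith
    rw [norm_smul, Real.norm_eq_abs, Real.abs_exp]
    refine mul_le_mul (Real.exp_le_exp.2 ?_) ?_ (norm_nonneg _) (Real.exp_pos _).le
    · exact (real_inner_le_norm x q).trans (mul_le_mul hxR hqn (norm_nonneg _) (abs_nonneg _))
    · rw [ContinuousLinearMap.norm_smulRight_apply, innerSL_apply_norm]
      exact mul_le_mul hxR hgC (norm_nonneg _) (abs_nonneg _)
  · refine Eventually.of_forall fun x q _ => ?_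
    have h1 : HasFDerivAt (fun q : E => (inner ℝ x q : ℝ)) (innerSL ℝ x) q :=
      (innerSL ℝ x).hasFDerivAt
    have h2 := h1.exp.smul_const (g x)
    convert h2 using 1
    ext v
    simp [smul_smul]

lemma expMoment_apply [IsFiniteMeasure ν] {F F' : Type*} [NormedAddCommGroup F] [NormedSpace ℝ F]
    [NormedAddCommGroup F'] [NormedSpace ℝ F'] (hK : IsCompact K) (hν : ν Kᶜ = 0)
    {g : E → F} (hg : Continuous g) (L : F →L[ℝ] F') [CompleteSpace F] [CompleteSpace F'] (p : E) :
    L (expMoment ν g p) = expMoment ν (fun x => L (g x)) p := by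
  unfold expMoment
  rw [← L.integral_comp_comm (integrable_of_continuous_of_null hK hν (by fun_prop))]
  simp

/-- The Laplace transform `Z(p) = ∫ e^{(x, p)} dν(x)`. -/
noncomputable def laplaceTransform (ν : Measure E) (p : E) : ℝ := expMoment ν (fun _ => (1 : ℝ)) p

/-- The gradient of the logarithm of the Laplace transform: the mean of the tilted measure. -/
noncomputable def tiltedMean (ν : Measure E) (p : E) : E :=
  (laplaceTransform ν p)⁻¹ • expMoment ν (fun x => x) p

lemma HasFullSupport.ne_zero (hν : HasFullSupport ν K) (hne : K.Nonempty) : ν ≠ 0 := by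
  rintro rfl
  obtain ⟨x, hx⟩ := hne
  simpa using hν.pos x hx 1 one_pos

lemma laplaceTransform_pos [IsFiniteMeasure ν] (hK : IsCompact K) (hne : K.Nonempty)
    (hν : HasFullSupport ν K) (p : E) : 0 < laplaceTransform ν p := by
  have := hν.ne_zero hne
  have : NeZero ν := ⟨this⟩
  have h := integral_exp_pos (μ := ν) (f := fun x => inner ℝ x p)
    (integrable_of_continuous_of_null hK hν.null (by fun_prop))
  simpa [laplaceTransform, expMoment] using h

/-- The barycentre of a probability measure carried by a closed convex set stays in that set. -/
lemma tiltedMean_mem [IsFiniteMeasure ν] (hK : IsCompact K) (hne : K.Nonempty) (hc : Convex ℝ K)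
    (hν : HasFullSupport ν K) (p : E) : tiltedMean ν p ∈ K := by
  have : NeZero ν := ⟨hν.ne_zero hne⟩
  have hi : Integrable (fun x => Real.exp (inner ℝ x p)) ν :=
    integrable_of_continuous_of_null hK hν.null (by fun_prop)
  have := isProbabilityMeasure_tilted hi
  have hmem : ∀ᵐ x ∂ν, x ∈ K := mem_ae_iff.2 hν.null
  have hmem' := (tilted_absolutelyContinuous ν fun x => (inner ℝ x p : ℝ)).ae_le hmem
  have hint : Integrable (fun x => x) (ν.tilted fun x => inner ℝ x p) :=
    integrable_of_continuous_of_null hK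
      (tilted_absolutelyContinuous ν (fun x => (inner ℝ x p : ℝ)) hν.null) continuous_id
  have h := hc.integral_mem hK.isClosed hmem' hint
  rw [integral_tilted] at h
  convert h using 1
  unfold tiltedMean laplaceTransform expMoment
  rw [← integral_smul]
  congr 1 with x
  simp [smul_smul, div_eq_inv_mul]

/-- The derivative of `tiltedMean`, the covariance operator of the tilted measure. -/
noncomputable def tiltedCov (ν : Measure E) (p : E) : E →L[ℝ] E :=
  (laplaceTransform ν p)⁻¹ • expMoment ν (fun x => (innerSL ℝ x).smulRight x) p +
  ((-(laplaceTransform ν p ^ 2)⁻¹) •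
    expMoment ν (fun x => (innerSL ℝ x).smulRight (1 : ℝ)) p).smulRight
      (expMoment ν (fun x => x) p)

lemma hasFDerivAt_tiltedMean [IsFiniteMeasure ν] (hK : IsCompact K) (hne : K.Nonempty)
    (hν : HasFullSupport ν K) (p : E) :
    HasFDerivAt (tiltedMean ν) (tiltedCov ν p) p := by
  have hZ := hasFDerivAt_expMoment hK hν.null (g := fun _ : E => (1 : ℝ)) continuous_const p
  have hM := hasFDerivAt_expMoment hK hν.null (g := fun x : E => x) continuous_id p
  have hZ' := (hasDerivAt_inv (laplaceTransform_pos hK hne hν p).ne').comp_hasFDerivAt p hZ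
  exact hZ'.smul hM

lemma expMoment_smulRight [IsFiniteMeasure ν] {F : Type*} [NormedAddCommGroup F] [NormedSpace ℝ F]
    [CompleteSpace F] (hK : IsCompact K) (hν : ν Kᶜ = 0) {g : E → F} (hg : Continuous g) (p v : E) :
    expMoment ν (fun x => (innerSL ℝ x).smulRight (g x)) p v =
      expMoment ν (fun x => (inner ℝ x v : ℝ) • g x) p := by
  have h := expMoment_apply hK hν (continuous_smulRight_innerSL hg)
    (ContinuousLinearMap.apply ℝ F v) p
  simpa using h

lemma inner_tiltedMean [IsFiniteMeasure ν] (hK : IsCompact K) (hν : HasFullSupport ν K) (p v : E) :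
    (inner ℝ (tiltedMean ν p) v : ℝ) =
      (laplaceTransform ν p)⁻¹ * expMoment ν (fun x => (inner ℝ x v : ℝ)) p := by
  unfold tiltedMean
  rw [inner_smul_left, real_inner_comm]
  have h := expMoment_apply hK hν.null (g := fun x : E => x) continuous_id (innerSL ℝ v) p
  simp only [innerSL_apply_apply] at h
  rw [h]
  simp [real_inner_comm]

/-- The quadratic form of the covariance at v is the variance of (x, v) under the tilted measure,
whence its sign. -/
lemma inner_tiltedCov [IsFiniteMeasure ν] (hK : IsCompact K) (hne : K.Nonempty)
    (hν : HasFullSupport ν K) (p v : E) :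
    (inner ℝ (tiltedCov ν p v) v : ℝ) = (laplaceTransform ν p)⁻¹ *
      expMoment ν (fun x => (inner ℝ x v - inner ℝ (tiltedMean ν p) v : ℝ) ^ 2) p := by
  have hZ := laplaceTransform_pos hK hne hν p
  set Z := laplaceTransform ν p with hZdef
  set m : ℝ := inner ℝ (tiltedMean ν p) v with hm
  have hmM : expMoment ν (fun x => (inner ℝ x v : ℝ)) p = Z * m := by
    rw [hm, inner_tiltedMean hK hν, ← hZdef]; field_simp
  have h2 : (inner ℝ (expMoment ν (fun x => x) p) v : ℝ) = Z * m := by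
    rw [hm, tiltedMean, inner_smul_left, ← hZdef]
    simp; field_simp
  have h1 : (inner ℝ (expMoment ν (fun x => (inner ℝ x v : ℝ) • x) p) v : ℝ) =
      expMoment ν (fun x => (inner ℝ x v : ℝ) ^ 2) p := by
    rw [real_inner_comm]
    have h := expMoment_apply hK hν.null (g := fun x : E => (inner ℝ x v : ℝ) • x) (by fun_prop)
      (innerSL ℝ v) p
    simp only [innerSL_apply_apply] at h
    rw [h]
    congr 1 with x
    rw [inner_smul_right, real_inner_comm, sq]
  have h3 : expMoment ν (fun x => (inner ℝ x v - m : ℝ) ^ 2) p =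
      expMoment ν (fun x => (inner ℝ x v : ℝ) ^ 2) p - Z * m ^ 2 := by
    have e : ∀ x : E, Real.exp (inner ℝ x p) • (inner ℝ x v - m : ℝ) ^ 2 =
        Real.exp (inner ℝ x p) • (inner ℝ x v : ℝ) ^ 2 -
        (2 * m) * (Real.exp (inner ℝ x p) • (inner ℝ x v : ℝ)) +
        m ^ 2 * (Real.exp (inner ℝ x p) • (1 : ℝ)) := by
      intro x; simp only [smul_eq_mul]; ring
    have i1 : Integrable (fun x : E => Real.exp (inner ℝ x p) • (inner ℝ x v : ℝ) ^ 2) ν :=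
      integrable_of_continuous_of_null hK hν.null (by fun_prop)
    have i2 : Integrable (fun x : E => (2 * m) * (Real.exp (inner ℝ x p) • (inner ℝ x v : ℝ))) ν :=
      integrable_of_continuous_of_null hK hν.null (by fun_prop)
    have i3 : Integrable (fun x : E => m ^ 2 * (Real.exp (inner ℝ x p) • (1 : ℝ))) ν :=
      integrable_of_continuous_of_null hK hν.null (by fun_prop)
    have key : expMoment ν (fun x => (inner ℝ x v - m : ℝ) ^ 2) p =
      expMoment ν (fun x => (inner ℝ x v : ℝ) ^ 2) p -
        (2 * m) * expMoment ν (fun x => (inner ℝ x v : ℝ)) p + m ^ 2 * Z := by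
      rw [hZdef]
      unfold laplaceTransform expMoment
      simp_rw [e]
      rw [integral_add (by exact i1.sub i2) i3, integral_sub i1 i2, integral_const_mul,
        integral_const_mul]
    rw [key, hmM]; ring
  rw [h3]
  unfold tiltedCov
  simp only [add_apply, smul_apply,
    ContinuousLinearMap.smulRight_apply, inner_add_left, inner_smul_left, ← hZdef]
  rw [expMoment_smulRight hK hν.null (g := fun x => x) continuous_id,
    expMoment_smulRight hK hν.null (g := fun _ => (1 : ℝ)) continuous_const, h1, h2]
  simp only [smul_eq_mul, mul_one, hmM]
  simp
  field_simp
  ring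

lemma inner_tiltedCov_nonneg [IsFiniteMeasure ν] (hK : IsCompact K) (hne : K.Nonempty)
    (hν : HasFullSupport ν K) (p v : E) : 0 ≤ (inner ℝ (tiltedCov ν p v) v : ℝ) := by
  rw [inner_tiltedCov hK hne hν]
  exact mul_nonneg (inv_nonneg.2 (laplaceTransform_pos hK hne hν p).le)
    (integral_nonneg fun x => smul_nonneg (Real.exp_pos _).le (sq_nonneg _))

/-- A functional that is not constant on K differs from its mean at some point of K, hence on a ball
about that point, and ν charges this ball. -/
lemma inner_tiltedCov_pos [IsFiniteMeasure ν] (hK : IsCompact K) (hν : HasFullSupport ν K)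
    (p : E) {v x y : E} (hx : x ∈ K) (hy : y ∈ K) (hxy : (inner ℝ x v : ℝ) ≠ inner ℝ y v) :
    0 < (inner ℝ (tiltedCov ν p v) v : ℝ) := by
  have hne : K.Nonempty := ⟨x, hx⟩
  rw [inner_tiltedCov hK hne hν]
  set m : ℝ := inner ℝ (tiltedMean ν p) v
  refine mul_pos (inv_pos.2 (laplaceTransform_pos hK hne hν p)) ?_
  obtain ⟨z, hz, hzm⟩ : ∃ z ∈ K, (inner ℝ z v : ℝ) ≠ m := by
    by_contra! h
    exact hxy ((h x hx).trans (h y hy).symm)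
  have hcont : Continuous fun x : E => (inner ℝ x v : ℝ) := by fun_prop
  obtain ⟨r, hr, hball⟩ := Metric.isOpen_iff.1 (isOpen_ne_fun hcont continuous_const) z hzm
  have hi : Integrable (fun x : E => Real.exp (inner ℝ x p) • ((inner ℝ x v : ℝ) - m) ^ 2) ν :=
    integrable_of_continuous_of_null hK hν.null (by fun_prop)
  unfold expMoment
  rw [integral_pos_iff_support_of_nonneg
    (fun x => smul_nonneg (Real.exp_pos _).le (sq_nonneg _)) hi]
  refine (hν.pos z hz r hr).trans_le (measure_mono fun w hw => ?_)
  have : (inner ℝ w v : ℝ) ≠ m := hball hw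
  simp [sub_ne_zero.2 this]

lemma hasFDerivAt_log_laplaceTransform [IsFiniteMeasure ν] (hK : IsCompact K) (hne : K.Nonempty)
    (hν : HasFullSupport ν K) (p : E) :
    HasFDerivAt (fun p => Real.log (laplaceTransform ν p)) (innerSL ℝ (tiltedMean ν p)) p := by
  have hZ := hasFDerivAt_expMoment hK hν.null (g := fun _ : E => (1 : ℝ)) continuous_const p
  have h := HasFDerivAt.log (f := laplaceTransform ν) hZ (laplaceTransform_pos hK hne hν p).ne'
  convert h using 1
  ext v
  rw [innerSL_apply_apply, inner_tiltedMean hK hν, smul_apply,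
    expMoment_smulRight hK hν.null continuous_const]
  simp

/-- Up to δ‖p‖ and a constant, log Z dominates the support function of K. On the ball of radius δ
about x the exponent is at least (x, p) - δ‖p‖, and a finite cover by balls of radius δ/2 bounds the
mass of such balls below, uniformly in x. -/
lemma exists_le_log_laplaceTransform [IsFiniteMeasure ν] (hK : IsCompact K) (hne : K.Nonempty)
    (hν : HasFullSupport ν K) {δ : ℝ} (hδ : 0 < δ) :
    ∃ C : ℝ, ∀ p, ∀ x ∈ K,
      (inner ℝ x p : ℝ) - δ * ‖p‖ - C ≤ Real.log (laplaceTransform ν p) := by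
  obtain ⟨t, htK, hcov⟩ := hK.elim_nhds_subcover (fun x => Metric.ball x (δ / 2))
    (fun x _ => Metric.ball_mem_nhds x (half_pos hδ))
  have htne : t.Nonempty := by
    obtain ⟨x, hx⟩ := hne
    obtain ⟨i, hi, -⟩ := mem_iUnion₂.1 (hcov hx)
    exact ⟨i, hi⟩
  obtain ⟨z, hzt, hzmin⟩ := t.exists_min_image (fun x => ν.real (Metric.ball x (δ / 2))) htne
  set c := ν.real (Metric.ball z (δ / 2)) with hc
  have hcpos : 0 < c := 
    ENNReal.toReal_pos (hν.pos z (htK z hzt) _ (half_pos hδ)).ne' (measure_ne_top _ _)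
  refine ⟨-Real.log c, fun p x hx => ?_⟩
  obtain ⟨i, hi, hxi⟩ := mem_iUnion₂.1 (hcov hx)
  have hsub : Metric.ball i (δ / 2) ⊆ Metric.ball x δ := by
    refine Metric.ball_subset_ball' ?_
    have := Metric.mem_ball.1 hxi
    rw [dist_comm] at this
    linarith
  have hcx : c ≤ ν.real (Metric.ball x δ) :=
    (hzmin i hi).trans (measureReal_mono hsub)
  rw [Real.le_log_iff_exp_le (laplaceTransform_pos hK hne hν p)]
  have e1 : Real.exp (inner ℝ x p - δ * ‖p‖ - -Real.log c) =
      Real.exp (inner ℝ x p - δ * ‖p‖) * c := by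
    rw [sub_neg_eq_add, Real.exp_add, Real.exp_log hcpos]
  have hi1 : Integrable (fun y : E => Real.exp (inner ℝ y p)) ν :=
    integrable_of_continuous_of_null hK hν.null (by fun_prop)
  calc _ = Real.exp (inner ℝ x p - δ * ‖p‖) * c := e1
    _ ≤ Real.exp (inner ℝ x p - δ * ‖p‖) * ν.real (Metric.ball x δ) := by gcongr
    _ = ∫ y in Metric.ball x δ, Real.exp (inner ℝ x p - δ * ‖p‖) ∂ν := by simp [mul_comm]
    _ ≤ ∫ y in Metric.ball x δ, Real.exp (inner ℝ y p) ∂ν := by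
        refine setIntegral_mono_on (integrable_const _).integrableOn hi1.integrableOn
          Metric.isOpen_ball.measurableSet fun y hy => Real.exp_le_exp.2 ?_
        have h1 : (inner ℝ x p : ℝ) - inner ℝ y p ≤ ‖x - y‖ * ‖p‖ := by
          rw [← inner_sub_left]; exact real_inner_le_norm _ _
        have h2 : ‖x - y‖ ≤ δ := by
          have := Metric.mem_ball.1 hy
          rw [dist_comm, dist_eq_norm] at this
          exact this.le
        have h3 := mul_le_mul_of_nonneg_right h2 (norm_nonneg p)
        linarith
    _ ≤ ∫ y, Real.exp (inner ℝ y p) ∂ν :=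
        setIntegral_le_integral hi1 (Eventually.of_forall fun y => (Real.exp_pos _).le)
    _ = laplaceTransform ν p := by simp [laplaceTransform, expMoment]

end LogLaplace

/-! ### The volume of K + hL as a polynomial in h -/

section MinkowskiPolynomial

open scoped Pointwise

variable {E : Type*} [NormedAddCommGroup E] [InnerProductSpace ℝ E] [FiniteDimensional ℝ E]

/-- The segment from the identity to L consists of operators with positive quadratic form, hence
invertible ones, so the determinant keeps its sign. Symmetry of L is not needed. -/
lemma det_pos_of_inner_pos (L : E →L[ℝ] E) (hL : ∀ v, v ≠ 0 → 0 < (inner ℝ (L v) v : ℝ)) :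
    0 < L.det := by
  let M : ℝ → E →L[ℝ] E := fun s => s • L + (1 - s) • ContinuousLinearMap.id ℝ E
  have hM : Continuous fun s => (M s).det :=
    ContinuousLinearMap.continuous_det.comp (by fun_prop)
  have hne : ∀ s ∈ Icc (0 : ℝ) 1, (M s).det ≠ 0 := by
    intro s hs h0
    have h1 := LinearMap.bot_lt_ker_of_det_eq_zero (f := (M s : E →ₗ[ℝ] E)) h0
    obtain ⟨v, hv, hv0⟩ := Submodule.exists_mem_ne_zero_of_ne_bot h1.ne'
    have hMv : M s v = 0 := hv
    have h2 : (inner ℝ (M s v) v : ℝ) = s * inner ℝ (L v) v + (1 - s) * inner ℝ v v := by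
      simp [M, inner_add_left, inner_smul_left]
    rw [hMv, inner_zero_left] at h2
    have h3 := hL v hv0
    have h4 : 0 < (inner ℝ v v : ℝ) := real_inner_self_pos.2 hv0
    rcases hs.1.eq_or_lt with h | h
    · subst h; linarith
    · have := mul_pos h h3
      have := mul_nonneg (sub_nonneg.2 hs.2) h4.le
      linarith
  have h0 : (M 0).det = 1 := by simp [M, ContinuousLinearMap.det]
  have h1 : (M 1).det = L.det := by simp [M]
  by_contra! hcon
  have hmem : (0 : ℝ) ∈ Icc (M 1).det (M 0).det := ⟨h1 ▸ hcon, by rw [h0]; exact zero_le_one⟩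
  obtain ⟨s, hs, hs0⟩ := intermediate_value_Icc' zero_le_one hM.continuousOn hmem
  exact hne s hs hs0

/-- The Lagrange weights for the nodes `1, …, d + 1`. -/
noncomputable def lagrangeWeight (d : ℕ) (i : ℕ) : Polynomial ℝ :=
  Lagrange.basis (Finset.range (d + 1)) (fun j : ℕ => (j : ℝ) + 1) i

/-- Interpolation is linear in the values of P, so it can be integrated over a parameter without
separate integrability of the coefficients. The nodes are positive because the determinant formula
for the volume is available only for h > 0. -/
lemma eval_eq_sum_lagrangeWeight {d : ℕ} {P : Polynomial ℝ} (hP : P.natDegree ≤ d) (h : ℝ) :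
    P.eval h = ∑ i ∈ Finset.range (d + 1), (lagrangeWeight d i).eval h * P.eval ((i : ℝ) + 1) := by
  have hinj : Set.InjOn (fun j : ℕ => (j : ℝ) + 1) (Finset.range (d + 1)) := by
    intro a _ b _ hab
    simpa using hab
  have hdeg : P.degree < (Finset.range (d + 1)).card := by
    rw [Finset.card_range]
    exact (Polynomial.degree_le_of_natDegree_le hP).trans_lt (by exact_mod_cast Nat.lt_succ_self d)
  conv_lhs => rw [Lagrange.eq_interpolate hinj hdeg]
  rw [Lagrange.interpolate_apply, Polynomial.eval_finsetSum]
  exact Finset.sum_congr rfl fun i _ => by simp [lagrangeWeight, mul_comm]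

lemma natDegree_lagrangeWeight {d i : ℕ} (hi : i ∈ Finset.range (d + 1)) :
    (lagrangeWeight d i).natDegree = d := by
  have hinj : Set.InjOn (fun j : ℕ => (j : ℝ) + 1) (Finset.range (d + 1)) := by
    intro a _ b _ hab
    simpa using hab
  simpa [lagrangeWeight] using Lagrange.natDegree_basis hinj hi

lemma exists_polynomial_det_add_smul (M N : E →L[ℝ] E) :
    ∃ P : Polynomial ℝ, P.natDegree ≤ Module.finrank ℝ E ∧
      ∀ h : ℝ, P.eval h = (M + h • N).det := by
  let b := Module.finBasis ℝ E
  let A := LinearMap.toMatrix b b (N : E →ₗ[ℝ] E)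
  let B := LinearMap.toMatrix b b (M : E →ₗ[ℝ] E)
  refine ⟨Matrix.det ((Polynomial.X : Polynomial ℝ) • A.map Polynomial.C + B.map Polynomial.C),
    by simpa using Polynomial.natDegree_det_X_add_C_le A B, fun h => ?_⟩
  rw [← Polynomial.coe_evalRingHom, RingHom.map_det]
  have : (M + h • N).det = LinearMap.det ((M : E →ₗ[ℝ] E) + h • (N : E →ₗ[ℝ] E)) := rfl
  rw [this, ← LinearMap.det_toMatrix b]
  congr 1
  ext i j
  simp [A, B, add_comm]
  exact mul_comm _ _

variable [MeasurableSpace E] [BorelSpace E] (μ : Measure E) [μ.IsAddHaarMeasure]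
  {K L : Set E} {ν ν' : Measure E} [IsFiniteMeasure ν] [IsFiniteMeasure ν']

lemma measure_interior_of_convex {s : Set E} (hs : Convex ℝ s) : μ (interior s) = μ s :=
  measure_interior_of_null_frontier (hs.addHaar_frontier μ)

/-- The required p is a critical point of log Z_ν + h log Z_ν' - (y, ·). This function is coercive
because y is interior, so it has a minimum. -/
lemma exists_tiltedMean_add_smul_eq (hK : IsCompact K) (hKne : K.Nonempty)
    (hν : HasFullSupport ν K) (hL : IsCompact L) (hLne : L.Nonempty)
    (hν' : HasFullSupport ν' L) {h : ℝ} (hh : 0 < h) {y : E} (hy : y ∈ interior (K + h • L)) :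
    ∃ p, tiltedMean ν p + h • tiltedMean ν' p = y := by
  obtain ⟨r, hr, hball⟩ := Metric.nhds_basis_closedBall.mem_iff.1 (mem_interior_iff_mem_nhds.1 hy)
  -- With this δ the two errors add up to (1 + h)δ‖p‖ = (r/2)‖p‖, half of the gain r‖p‖ from the
  -- ball about y.
  have hδ : 0 < r / (2 * (1 + h)) := by positivity
  obtain ⟨C, hC⟩ := exists_le_log_laplaceTransform hK hKne hν hδ
  obtain ⟨C', hC'⟩ := exists_le_log_laplaceTransform hL hLne hν' hδ
  let g : E → ℝ := fun p => Real.log (laplaceTransform ν p) +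
    h * Real.log (laplaceTransform ν' p) - inner ℝ y p
  have hg : ∀ p, HasFDerivAt g (innerSL ℝ (tiltedMean ν p) + h • innerSL ℝ (tiltedMean ν' p) -
      innerSL ℝ y) p := fun p =>
    ((hasFDerivAt_log_laplaceTransform hK hKne hν p).add
      ((hasFDerivAt_log_laplaceTransform hL hLne hν' p).const_mul h)).sub
      (innerSL ℝ y).hasFDerivAt
  have hbound : ∀ p, r / 2 * ‖p‖ + (-C - h * C') ≤ g p := by
    intro p
    have hz : y + (r / ‖p‖) • p ∈ K + h • L := by
      apply hball
      rw [Metric.mem_closedBall, dist_eq_norm, add_sub_cancel_left, norm_smul, norm_div, norm_norm,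
        Real.norm_of_nonneg hr.le]
      by_cases hp : ‖p‖ = 0
      · simp [hp, hr.le]
      · rw [div_mul_cancel₀ _ hp]
    obtain ⟨a, ha, b', ⟨b, hb, rfl⟩, hab⟩ := hz
    have h1 := hC p a ha
    have h2 := mul_le_mul_of_nonneg_left (hC' p b hb) hh.le
    have h3 : (inner ℝ a p : ℝ) + h * inner ℝ b p = inner ℝ y p + r * ‖p‖ := by
      have := congrArg (fun z => (inner ℝ z p : ℝ)) hab
      simp only [inner_add_left, inner_smul_left, real_inner_self_eq_norm_sq] at this
      simp only [conj_trivial] at this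
      rw [this]
      by_cases hp : ‖p‖ = 0
      · simp [hp]
      · field_simp
    have h4 : r / (2 * (1 + h)) * ‖p‖ + h * (r / (2 * (1 + h)) * ‖p‖) = r / 2 * ‖p‖ := by
      field_simp
    simp only [g]
    linarith
  have hlim : Tendsto g (cocompact E) atTop := by
    refine tendsto_atTop_mono hbound (tendsto_atTop_add_const_right _ _ ?_)
    exact (tendsto_norm_cocompact_atTop (E := E)).const_mul_atTop (by positivity)
  have hcont : Continuous g := continuous_iff_continuousAt.2 fun p => (hg p).continuousAt
  obtain ⟨p, hp⟩ := hcont.exists_forall_le hlim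
  have hmin : IsLocalMin g p := Eventually.of_forall hp
  have h0 := hmin.hasFDerivAt_eq_zero (hg p)
  refine ⟨p, ?_⟩
  have h1 : innerSL ℝ (tiltedMean ν p + h • tiltedMean ν' p - y) = 0 := by
    rw [← h0]; simp
  have h2 := congrArg (fun f => f (tiltedMean ν p + h • tiltedMean ν' p - y)) h1
  simp only [innerSL_apply_apply, zero_apply, inner_self_eq_zero] at h2
  exact sub_eq_zero.1 h2

lemma inner_tiltedCov_add_smul_pos (hK : IsCompact K) (hKne : K.Nonempty)
    (hν : HasFullSupport ν K) (hL : IsCompact L) (hLne : L.Nonempty)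
    (hν' : HasFullSupport ν' L)
    (hnd : ∀ v : E, v ≠ 0 → (∃ x ∈ K, ∃ y ∈ K, (inner ℝ x v : ℝ) ≠ inner ℝ y v) ∨
      ∃ x ∈ L, ∃ y ∈ L, (inner ℝ x v : ℝ) ≠ inner ℝ y v) {h : ℝ} (hh : 0 < h) (p v : E)
    (hv : v ≠ 0) : 0 < (inner ℝ ((tiltedCov ν p + h • tiltedCov ν' p) v) v : ℝ) := by
  simp only [add_apply, smul_apply, inner_add_left, inner_smul_left, conj_trivial]
  have h1 := inner_tiltedCov_nonneg hK hKne hν p v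
  have h2 := inner_tiltedCov_nonneg hL hLne hν' p v
  rcases hnd v hv with ⟨x, hx, y, hy, hxy⟩ | ⟨x, hx, y, hy, hxy⟩
  · have := inner_tiltedCov_pos hK hν p hx hy hxy
    positivity
  · have := inner_tiltedCov_pos hL hν' p hx hy hxy
    positivity

/-- Change of variables for T. It is injective, since (p - q, T) increases strictly along the
segment from q to p; its range lies between the interior of K + hL and K + hL, which differ by a
null set by convexity. -/
lemma lintegral_det_tiltedCov (hK : IsCompact K) (hKne : K.Nonempty) (hKc : Convex ℝ K)
    (hν : HasFullSupport ν K) (hL : IsCompact L) (hLne : L.Nonempty) (hLc : Convex ℝ L)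
    (hν' : HasFullSupport ν' L)
    (hnd : ∀ v : E, v ≠ 0 → (∃ x ∈ K, ∃ y ∈ K, (inner ℝ x v : ℝ) ≠ inner ℝ y v) ∨
      ∃ x ∈ L, ∃ y ∈ L, (inner ℝ x v : ℝ) ≠ inner ℝ y v) {h : ℝ} (hh : 0 < h) :
    ∫⁻ p, ENNReal.ofReal (tiltedCov ν p + h • tiltedCov ν' p).det ∂μ = μ (K + h • L) := by
  let T : E → E := fun p => tiltedMean ν p + h • tiltedMean ν' p
  have hT : ∀ p, HasFDerivAt T (tiltedCov ν p + h • tiltedCov ν' p) p := fun p =>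
    (hasFDerivAt_tiltedMean hK hKne hν p).add ((hasFDerivAt_tiltedMean hL hLne hν' p).const_smul h)
  have hpos := inner_tiltedCov_add_smul_pos hK hKne hν hL hLne hν' hnd hh
  have hinj : Function.Injective T := by
    intro p q hpq
    by_contra hne
    let f : ℝ → ℝ := fun s => inner ℝ (p - q) (T (q + s • (p - q)))
    have hf : ∀ s, HasDerivAt f (inner ℝ (p - q) ((tiltedCov ν (q + s • (p - q)) +
        h • tiltedCov ν' (q + s • (p - q))) (p - q))) s := by
      intro s
      have h1 : HasDerivAt (fun s : ℝ => q + s • (p - q)) (p - q) s := by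
        simpa using ((hasDerivAt_id s).smul_const (p - q)).const_add q
      have h2 := (hT (q + s • (p - q))).comp_hasDerivAt s h1
      exact (innerSL ℝ (p - q)).hasFDerivAt.comp_hasDerivAt s h2
    have hmono : StrictMono f := strictMono_of_hasDerivAt_pos hf fun s => by
      rw [real_inner_comm]; exact hpos _ _ (sub_ne_zero.2 hne)
    have := hmono zero_lt_one
    simp [f, hpq] at this
  have hdet : ∀ p, |(tiltedCov ν p + h • tiltedCov ν' p).det| =
      (tiltedCov ν p + h • tiltedCov ν' p).det := fun p =>
    abs_of_pos (det_pos_of_inner_pos _ (hpos p))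
  have hcv := lintegral_abs_det_fderiv_eq_addHaar_image μ MeasurableSet.univ
    (fun p _ => (hT p).hasFDerivWithinAt) hinj.injOn
  simp only [hdet, Measure.restrict_univ, image_univ] at hcv
  rw [hcv]
  apply le_antisymm
  · refine measure_mono ?_
    rintro _ ⟨p, rfl⟩
    exact add_mem_add (tiltedMean_mem hK hKne hKc hν p)
      (smul_mem_smul_set (tiltedMean_mem hL hLne hLc hν' p))
  · rw [← measure_interior_of_convex μ (hKc.add (hLc.smul h))]
    refine measure_mono fun y hy => ?_
    exact exists_tiltedMean_add_smul_eq hK hKne hν hL hLne hν' hh hy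

/-- Here K and L lie in hyperplanes orthogonal to the same v, and so does K + hL, which therefore
has empty interior. -/
lemma measure_add_smul_eq_zero (hK : Convex ℝ K) (hL : Convex ℝ L) {v : E} (hv : v ≠ 0)
    (hKv : ∀ x ∈ K, ∀ y ∈ K, (inner ℝ x v : ℝ) = inner ℝ y v)
    (hLv : ∀ x ∈ L, ∀ y ∈ L, (inner ℝ x v : ℝ) = inner ℝ y v) (h : ℝ) : μ (K + h • L) = 0 := by
  rw [← measure_interior_of_convex μ (hK.add (hL.smul h))]
  suffices interior (K + h • L) = ∅ by simp [this]
  by_contra hne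
  obtain ⟨y, hy⟩ := nonempty_iff_ne_empty.2 hne
  have hconst : ∀ z ∈ K + h • L, ∀ w ∈ K + h • L, (inner ℝ z v : ℝ) = inner ℝ w v := by
    rintro _ ⟨a, ha, _, ⟨b, hb, rfl⟩, rfl⟩ _ ⟨a', ha', _, ⟨b', hb', rfl⟩, rfl⟩
    simp only [inner_add_left, inner_smul_left, hKv a ha a' ha', hLv b hb b' hb']
  have hcont : Continuous fun t : ℝ => y + t • v := by fun_prop
  have hev : ∀ᶠ t : ℝ in 𝓝 0, y + t • v ∈ K + h • L := by
    have : K + h • L ∈ 𝓝 (y + (0 : ℝ) • v) := by simpa using mem_interior_iff_mem_nhds.1 hy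
    exact hcont.continuousAt this
  obtain ⟨ε, hε, hball⟩ := Metric.eventually_nhds_iff_ball.1 hev
  have h1 := hball (ε / 2) (by simp [abs_of_pos hε, hε])
  have h2 := hconst _ h1 _ (interior_subset hy)
  rw [inner_add_left, inner_smul_left] at h2
  have h3 : 0 < (inner ℝ v v : ℝ) := real_inner_self_pos.2 hv
  have h4 : ε / 2 * (inner ℝ v v : ℝ) = 0 := by simpa using h2
  have := mul_pos (half_pos hε) h3
  linarith

/-- The volume of `K + h L` is a polynomial in `h > 0` of degree at most the dimension
(Minkowski's theorem for two bodies), in the form of Lagrange's interpolation formula. -/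
theorem measureReal_add_smul_eq_sum (hK : IsCompact K) (hKne : K.Nonempty) (hKc : Convex ℝ K)
    (hL : IsCompact L) (hLne : L.Nonempty) (hLc : Convex ℝ L) {h : ℝ} (hh : 0 < h) :
    μ.real (K + h • L) = ∑ i ∈ Finset.range (Module.finrank ℝ E + 1),
      (lagrangeWeight (Module.finrank ℝ E) i).eval h * μ.real (K + ((i : ℝ) + 1) • L) := by
  by_cases hnd : ∀ v : E, v ≠ 0 → (∃ x ∈ K, ∃ y ∈ K, (inner ℝ x v : ℝ) ≠ inner ℝ y v) ∨
      ∃ x ∈ L, ∃ y ∈ L, (inner ℝ x v : ℝ) ≠ inner ℝ y v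
  · obtain ⟨ν, _, hν⟩ := exists_hasFullSupport hKne
    obtain ⟨ν', _, hν'⟩ := exists_hasFullSupport hLne
    have hlin : ∀ {h : ℝ}, 0 < h →
        ∫⁻ p, ENNReal.ofReal (tiltedCov ν p + h • tiltedCov ν' p).det ∂μ = μ (K + h • L) :=
      lintegral_det_tiltedCov μ hK hKne hKc hν hL hLne hLc hν' hnd
    have hmeas : ∀ h : ℝ, Measurable fun p => (tiltedCov ν p + h • tiltedCov ν' p).det := by
      intro h
      have e : (fun p => tiltedCov ν p + h • tiltedCov ν' p) =
          fun p => fderiv ℝ (tiltedMean ν) p + h • fderiv ℝ (tiltedMean ν') p := by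
        ext1 p
        rw [(hasFDerivAt_tiltedMean hK hKne hν p).fderiv,
          (hasFDerivAt_tiltedMean hL hLne hν' p).fderiv]
      refine ContinuousLinearMap.continuous_det.measurable.comp ?_
      rw [e]
      exact (measurable_fderiv ℝ _).add ((measurable_fderiv ℝ _).const_smul h)
    have hnonneg : ∀ {h : ℝ}, 0 < h → ∀ p, 0 ≤ (tiltedCov ν p + h • tiltedCov ν' p).det :=
      fun hh p => (det_pos_of_inner_pos _
        (inner_tiltedCov_add_smul_pos hK hKne hν hL hLne hν' hnd hh p)).le
    have hint : ∀ {h : ℝ}, 0 < h →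
        Integrable (fun p => (tiltedCov ν p + h • tiltedCov ν' p).det) μ := by
      intro h hh
      refine ⟨(hmeas h).aestronglyMeasurable, ?_⟩
      rw [hasFiniteIntegral_iff_ofReal (Eventually.of_forall (hnonneg hh)), hlin hh]
      exact (hK.add (hL.smul h)).measure_lt_top
    have hval : ∀ {h : ℝ}, 0 < h →
        μ.real (K + h • L) = ∫ p, (tiltedCov ν p + h • tiltedCov ν' p).det ∂μ := by
      intro h hh
      rw [integral_eq_lintegral_of_nonneg_ae (Eventually.of_forall (hnonneg hh))
        (hmeas h).aestronglyMeasurable, hlin hh, Measure.real]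
    have hi : ∀ i : ℕ, (0 : ℝ) < (i : ℝ) + 1 := fun i => by positivity
    rw [hval hh, Finset.sum_congr rfl fun i _ => by rw [hval (hi i), ← integral_const_mul],
      ← integral_finsetSum _ fun i _ => (hint (hi i)).const_mul _]
    -- The interpolation identity holds for the determinant at each p; only integrability at h and
    -- at the nodes was needed.
    congr 1 with p
    obtain ⟨P, hPdeg, hP⟩ := exists_polynomial_det_add_smul (tiltedCov ν p) (tiltedCov ν' p)
    simp only [← hP]
    exact eval_eq_sum_lagrangeWeight hPdeg h
  · push Not at hnd
    obtain ⟨v, hv, hKv, hLv⟩ := hnd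
    simp [Measure.real, measure_add_smul_eq_zero μ hKc hLc hv hKv hLv]

end MinkowskiPolynomial

/-! ### The operator exponential and the derivative of its determinant -/

section OperatorExponential

variable {E : Type*} [NormedAddCommGroup E] [NormedSpace ℝ E] [FiniteDimensional ℝ E]

/-- The operator exponential `e^{cA}`. -/
noncomputable def opExp (A : E →L[ℝ] E) (c : ℝ) : E →L[ℝ] E := NormedSpace.exp (c • A)

lemma opExp_zero (A : E →L[ℝ] E) : opExp A 0 = ContinuousLinearMap.id ℝ E := by
  unfold opExp
  rw [zero_smul, NormedSpace.exp_zero]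
  rfl

lemma hasDerivAt_opExp_zero (A : E →L[ℝ] E) : HasDerivAt (opExp A) A 0 := by
  have : CompleteSpace E := FiniteDimensional.complete ℝ E
  have h := hasDerivAt_exp_smul_const (𝕂 := ℝ) A (0 : ℝ)
  rw [zero_smul, NormedSpace.exp_zero, one_mul] at h
  exact h

lemma continuous_opExp (A : E →L[ℝ] E) : Continuous (opExp A) := by
  have : CompleteSpace E := FiniteDimensional.complete ℝ E
  exact continuous_iff_continuousAt.2 fun c =>
    (hasDerivAt_exp_smul_const (𝕂 := ℝ) A c).continuousAt

lemma opExp_comp_neg (A : E →L[ℝ] E) (c : ℝ) :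
    (opExp A c).comp (opExp A (-c)) = ContinuousLinearMap.id ℝ E := by
  have : CompleteSpace E := FiniteDimensional.complete ℝ E
  let _ : NormedAlgebra ℚ (E →L[ℝ] E) := NormedAlgebra.restrictScalars ℚ ℝ _
  have h : NormedSpace.exp (c • A + (-c) • A) =
      NormedSpace.exp (c • A) * NormedSpace.exp ((-c) • A) :=
    NormedSpace.exp_add_of_commute (((Commute.refl A).smul_left c).smul_right (-c))
  rw [← add_smul, add_neg_cancel, zero_smul, NormedSpace.exp_zero] at h
  exact h.symm

lemma differentiable_det : Differentiable ℝ fun L : E →L[ℝ] E => L.det := by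
  let b := Module.finBasis ℝ E
  have hdet : (fun L : E →L[ℝ] E => L.det) = fun L : E →L[ℝ] E =>
      ∑ σ : Equiv.Perm (Fin (Module.finrank ℝ E)), ((Equiv.Perm.sign σ : ℤ) : ℝ) *
        ∏ i, b.repr (L (b i)) (σ i) := by
    ext1 L
    have : L.det = LinearMap.det (L : E →ₗ[ℝ] E) := rfl
    rw [this, ← LinearMap.det_toMatrix b, Matrix.det_apply']
    simp [LinearMap.toMatrix_apply]
  have hentry : ∀ i j, ContDiff ℝ 1 fun L : E →L[ℝ] E => b.repr (L (b i)) j := by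
    intro i j
    have h : ContDiff ℝ 1 fun x : E => b.repr x j :=
      (LinearMap.toContinuousLinearMap (b.coord j)).contDiff
    exact h.comp (ContinuousLinearMap.apply ℝ E (b i)).contDiff
  rw [hdet]
  refine Differentiable.fun_sum fun σ _ => Differentiable.const_mul ?_ _
  exact (contDiff_prod fun i _ => hentry i (σ i)).differentiable one_ne_zero

lemma hasDerivAt_det_one_add_smul (A : E →L[ℝ] E) :
    HasDerivAt (fun c : ℝ => (ContinuousLinearMap.id ℝ E + c • A).det)
      (LinearMap.trace ℝ E A.toLinearMap) 0 := by
  let b := Module.finBasis ℝ E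
  let M := LinearMap.toMatrix b b (A : E →ₗ[ℝ] E)
  let P : Polynomial ℝ := Matrix.det (1 + (Polynomial.X : Polynomial ℝ) • M.map Polynomial.C)
  have hP : (fun c : ℝ => (ContinuousLinearMap.id ℝ E + c • A).det) = fun c => P.eval c := by
    ext1 c
    have h1 : (ContinuousLinearMap.id ℝ E + c • A).det =
        LinearMap.det (LinearMap.id + c • (A : E →ₗ[ℝ] E)) := rfl
    simp only [P]
    rw [h1, ← LinearMap.det_toMatrix b, ← Polynomial.coe_evalRingHom, RingHom.map_det]
    congr 1
    ext i j
    simp [M, Matrix.one_apply, apply_ite]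
    exact mul_comm _ _
  have h2 := P.hasDerivAt 0
  rw [Matrix.derivative_det_one_add_X_smul] at h2
  rw [hP, LinearMap.trace_eq_matrix_trace ℝ b]
  exact h2

/-- The curves e^{cA} and I + cA have the same tangent at c = 0, so the chain rule transfers the
derivative of the determinant from the line to the exponential. -/
lemma hasDerivAt_det_opExp (A : E →L[ℝ] E) :
    HasDerivAt (fun c : ℝ => (opExp A c).det) (LinearMap.trace ℝ E A.toLinearMap) 0 := by
  have hd := (differentiable_det (ContinuousLinearMap.id ℝ E)).hasFDerivAt
  have h1 : HasDerivAt (fun c : ℝ => ContinuousLinearMap.id ℝ E + c • A) A 0 := by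
    simpa using ((hasDerivAt_id (0 : ℝ)).smul_const A).const_add (ContinuousLinearMap.id ℝ E)
  have h2 := HasFDerivAt.comp_hasDerivAt_of_eq (0 : ℝ) hd h1 (by simp)
  have h3 := HasFDerivAt.comp_hasDerivAt_of_eq (0 : ℝ) hd (hasDerivAt_opExp_zero A)
    (opExp_zero A).symm
  rw [← h2.unique (hasDerivAt_det_one_add_smul A)]
  exact h3

end OperatorExponential

/-! ### Convex bodies: continuity of the volume, support functions, linear images -/

section ConvexBodies

open scoped Pointwise

variable {n : ℕ}

/-- The closed unit ball. -/
def unitBall (n : ℕ) : Conv n where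
  carrier := Metric.closedBall 0 1
  convex' := convex_closedBall 0 1
  isCompact' := isCompact_closedBall 0 1
  nonempty' := ⟨0, by simp⟩

lemma mem_unitBall {x : EuclideanSpace ℝ (Fin n)} : x ∈ unitBall n ↔ ‖x‖ ≤ 1 :=
  mem_closedBall_zero_iff

lemma mem_add_smul_iff {K L : Conv n} {h : ℝ} {z : EuclideanSpace ℝ (Fin n)} :
    z ∈ K + h • L ↔ ∃ x ∈ K, ∃ y ∈ L, x + h • y = z := by
  rw [← SetLike.mem_coe, ConvexBody.coe_add, ConvexBody.coe_smul, Set.mem_add]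
  constructor
  · rintro ⟨x, hx, _, ⟨y, hy, rfl⟩, rfl⟩
    exact ⟨x, hx, y, hy, rfl⟩
  · rintro ⟨x, hx, y, hy, rfl⟩
    exact ⟨x, hx, _, ⟨y, hy, rfl⟩, rfl⟩

lemma mem_add_iff {K L : Conv n} {z : EuclideanSpace ℝ (Fin n)} :
    z ∈ K + L ↔ ∃ x ∈ K, ∃ y ∈ L, x + y = z := by
  rw [← SetLike.mem_coe, ConvexBody.coe_add, Set.mem_add]; rfl

lemma add_smul_conv (K : Conv n) {a b : ℝ} (ha : 0 ≤ a) (hb : 0 ≤ b) :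
    (a + b) • K = a • K + b • K :=
  SetLike.ext' (Convex.add_smul K.convex ha hb)

lemma zero_smul_conv (K : Conv n) : (0 : ℝ) • K = 0 :=
  SetLike.ext' (Set.zero_smul_set K.nonempty)

lemma vol_mono {K L : Conv n} (h : K ≤ L) : vol K ≤ vol L :=
  ENNReal.toReal_mono L.isCompact.measure_lt_top.ne (measure_mono h)

lemma vol_nonneg (K : Conv n) : 0 ≤ vol K := ENNReal.toReal_nonneg

lemma vol_le_vol_add (K L : Conv n) : vol K ≤ vol (K + L) := by
  obtain ⟨y, hy⟩ := L.nonempty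
  have h : volume ((fun x => x + y) '' (K : Set (EuclideanSpace ℝ (Fin n)))) = 
      volume (K : Set (EuclideanSpace ℝ (Fin n))) := by
    rw [image_add_right, measure_preimage_add_right]
  unfold vol
  rw [← h]
  refine ENNReal.toReal_mono (K + L).isCompact.measure_lt_top.ne (measure_mono ?_)
  rintro _ ⟨x, hx, rfl⟩
  exact mem_add_iff.2 ⟨x, hx, y, hy, rfl⟩

lemma vol_smul (K : Conv n) {c : ℝ} (hc : 0 ≤ c) : vol (c • K) = c ^ n * vol K := by
  unfold vol
  rw [ConvexBody.coe_smul, Measure.addHaar_smul, ENNReal.toReal_mul, finrank_euclideanSpace_fin,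
    abs_of_nonneg (by positivity), ENNReal.toReal_ofReal (by positivity)]

/-- K + hL contains a translate of K and lies in the closed hR-neighbourhood of K, R being a bound
for the norm on L; the volumes of these neighbourhoods decrease to that of K. -/
lemma tendsto_vol_add_smul (K L : Conv n) :
    Tendsto (fun h : ℝ => vol (K + h • L)) (𝓝[≥] 0) (𝓝 (vol K)) := by
  obtain ⟨R, hR0, hR⟩ := L.isBounded.exists_pos_norm_le
  have h1 := tendsto_measure_cthickening_of_isCompact (μ := (volume : Measure (EuclideanSpace ℝ (Fin n)))) K.isCompact
  have h2 : Tendsto (fun h : ℝ => h * R) (𝓝[≥] 0) (𝓝 0) := by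
    have : Tendsto (fun h : ℝ => h * R) (𝓝 0) (𝓝 (0 * R)) := by
      exact (continuous_mul_const R).tendsto 0
    rw [zero_mul] at this
    exact this.mono_left nhdsWithin_le_nhds
  have h3 := (ENNReal.tendsto_toReal K.isCompact.measure_lt_top.ne).comp (h1.comp h2)
  refine tendsto_of_tendsto_of_tendsto_of_le_of_le' tendsto_const_nhds h3
    (Eventually.of_forall fun h => vol_le_vol_add _ _) ?_
  filter_upwards [self_mem_nhdsWithin] with h hh
  have hh : 0 ≤ h := hh
  refine ENNReal.toReal_mono (K.isCompact.cthickening).measure_lt_top.ne (measure_mono ?_)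
  intro z hz
  obtain ⟨x, hx, y, hy, rfl⟩ := mem_add_smul_iff.1 hz
  refine Metric.mem_cthickening_of_dist_le _ x _ _ hx ?_
  rw [dist_eq_norm, add_sub_cancel_left, norm_smul, Real.norm_of_nonneg hh]
  exact mul_le_mul_of_nonneg_left (hR y hy) hh

lemma vol_add_smul_eq_sum (K L : Conv n) {h : ℝ} (hh : 0 ≤ h) :
    vol (K + h • L) = ∑ i ∈ Finset.range (n + 1),
      (lagrangeWeight n i).eval h * vol (K + ((i : ℝ) + 1) • L) := by
  have hpos : ∀ {h : ℝ}, 0 < h → vol (K + h • L) = ∑ i ∈ Finset.range (n + 1),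
      (lagrangeWeight n i).eval h * vol (K + ((i : ℝ) + 1) • L) := by
    intro h hh
    have := measureReal_add_smul_eq_sum volume K.isCompact K.nonempty K.convex L.isCompact
      L.nonempty L.convex hh
    rw [finrank_euclideanSpace_fin] at this
    exact this
  rcases hh.eq_or_lt with rfl | hh
  -- The value h = 0 follows from right continuity of both sides.
  · have h1 := (tendsto_vol_add_smul K L).mono_left (nhdsWithin_mono 0 Ioi_subset_Ici_self)
    have hc : Continuous fun h : ℝ => ∑ i ∈ Finset.range (n + 1),
      (lagrangeWeight n i).eval h * vol (K + ((i : ℝ) + 1) • L) := by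
      refine continuous_finsetSum _ fun i _ => ?_
      exact (lagrangeWeight n i).continuous.mul continuous_const
    have h2 := (hc.tendsto 0).mono_left (nhdsWithin_le_nhds (s := Ioi 0))
    have h3 : (fun h : ℝ => vol (K + h • L)) =ᶠ[𝓝[>] 0] fun h : ℝ => ∑ i ∈ Finset.range (n + 1),
        (lagrangeWeight n i).eval h * vol (K + ((i : ℝ) + 1) • L) := by
      filter_upwards [self_mem_nhdsWithin] with h hh using hpos hh
    rw [zero_smul_conv, add_zero]
    exact tendsto_nhds_unique (h1.congr' h3) h2
  · exact hpos hh

lemma exists_mem_dist_le {K L : Conv n} {x : EuclideanSpace ℝ (Fin n)} (hx : x ∈ K) :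
    ∃ y ∈ L, dist x y ≤ dist K L := by
  obtain ⟨y, hy, hxy⟩ := L.isCompact.exists_infDist_eq_dist L.nonempty x
  refine ⟨y, hy, ?_⟩
  rw [← hxy]
  exact Metric.infDist_le_hausdorffDist_of_mem hx ConvexBody.hausdorffEDist_ne_top

lemma dist_le_of_exists {K L : Conv n} {r : ℝ} (hr : 0 ≤ r) (h1 : ∀ x ∈ K, ∃ y ∈ L, dist x y ≤ r)
    (h2 : ∀ x ∈ L, ∃ y ∈ K, dist x y ≤ r) : dist K L ≤ r :=
  Metric.hausdorffDist_le_of_mem_dist hr h1 h2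

lemma le_add_smul_unitBall {K L : Conv n} {r : ℝ} (h : dist K L ≤ r) :
    K ≤ L + r • unitBall n := by
  intro x hx
  obtain ⟨y, hy, hxy⟩ := exists_mem_dist_le (L := L) hx
  have hxr : ‖x - y‖ ≤ r := by rw [← dist_eq_norm]; exact hxy.trans h
  rcases (norm_nonneg (x - y)).eq_or_lt with h0 | h0
  · refine mem_add_smul_iff.2 ⟨y, hy, 0, mem_unitBall.2 (by simp), ?_⟩
    rw [smul_zero, add_zero]
    exact (sub_eq_zero.1 (norm_eq_zero.1 h0.symm)).symm
  · have hr : 0 < r := h0.trans_le hxr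
    refine mem_add_smul_iff.2 ⟨y, hy, r⁻¹ • (x - y), mem_unitBall.2 ?_, ?_⟩
    · rw [norm_smul, norm_inv, Real.norm_of_nonneg hr.le, inv_mul_le_iff₀ hr, mul_one]
      exact hxr
    · rw [smul_inv_smul₀ hr.ne', add_sub_cancel]

lemma add_le_add_conv {K K' L L' : Conv n} (h : K ≤ K') (h' : L ≤ L') : K + L ≤ K' + L' := by
  intro z hz
  obtain ⟨x, hx, y, hy, rfl⟩ := mem_add_iff.1 hz
  exact mem_add_iff.2 ⟨x, h hx, y, h' hy, rfl⟩

/-- Upper bound: L ⊆ K + dB with d = dist L K. Lower bound: K ⊆ L + dB, and interpolation bounds the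
growth of V[L + dB] over V[L] uniformly in L near K. -/
lemma continuous_vol : Continuous (vol : Conv n → ℝ) := by
  rw [continuous_iff_continuousAt]
  intro K
  have hdist : Tendsto (fun L : Conv n => dist L K) (𝓝 K) (𝓝 0) := by
    simpa using (continuous_id.dist continuous_const : Continuous fun L : Conv n => dist L K).tendsto K
  -- When dist L K ≤ 1, L + (i + 1)B ⊆ K + (i + 2)B, so the node volumes are bounded independently
  -- of L.
  let ω : ℝ → ℝ := fun ε => ∑ i ∈ Finset.range (n + 1),
    |(lagrangeWeight n i).eval ε - (lagrangeWeight n i).eval 0| *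
      vol (K + ((i : ℝ) + 2) • unitBall n)
  have hω : Continuous ω := by
    refine continuous_finsetSum _ fun i _ => ?_
    have := (lagrangeWeight n i).continuous
    fun_prop
  have hω0 : ω 0 = 0 := by simp [ω]
  have hlow : Tendsto (fun L : Conv n => vol K - ω (dist L K)) (𝓝 K) (𝓝 (vol K)) := by
    have := (hω.tendsto 0).comp hdist
    rw [hω0] at this
    simpa using (tendsto_const_nhds (x := vol K)).sub this
  have hup : Tendsto (fun L : Conv n => vol (K + dist L K • unitBall n)) (𝓝 K) (𝓝 (vol K)) :=
    (tendsto_vol_add_smul K (unitBall n)).comp (tendsto_nhdsWithin_iff.2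
      ⟨hdist, Eventually.of_forall fun L => dist_nonneg⟩)
  refine tendsto_of_tendsto_of_tendsto_of_le_of_le' hlow hup ?_
    (Eventually.of_forall fun L => vol_mono (le_add_smul_unitBall le_rfl))
  filter_upwards [Metric.ball_mem_nhds K one_pos] with L hL
  have hL1 : dist L K ≤ 1 := (Metric.mem_ball.1 hL).le
  have h1 : vol K ≤ vol (L + dist L K • unitBall n) :=
    vol_mono (le_add_smul_unitBall (dist_comm K L).le)
  have h2 := vol_add_smul_eq_sum L (unitBall n) (dist_nonneg (x := L) (y := K))
  have h3 := vol_add_smul_eq_sum L (unitBall n) le_rfl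
  rw [zero_smul_conv, add_zero] at h3
  have h4 : ∀ i : ℕ, vol (L + ((i : ℝ) + 1) • unitBall n) ≤
      vol (K + ((i : ℝ) + 2) • unitBall n) := by
    intro i
    refine vol_mono ?_
    have e : K + ((i : ℝ) + 2) • unitBall n =
        (K + (1 : ℝ) • unitBall n) + ((i : ℝ) + 1) • unitBall n := by
      rw [add_assoc, ← add_smul_conv _ (by positivity) (by positivity)]
      congr 2; ring
    rw [e]
    exact add_le_add_conv (le_add_smul_unitBall hL1) le_rfl
  have h5 : vol (L + dist L K • unitBall n) - vol L ≤ ω (dist L K) := by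
    rw [h2, h3, ← Finset.sum_sub_distrib]
    refine Finset.sum_le_sum fun i _ => ?_
    rw [← sub_mul]
    exact (mul_le_mul_of_nonneg_right (le_abs_self _) (vol_nonneg _)).trans
      (mul_le_mul_of_nonneg_left (h4 i) (abs_nonneg _))
  linarith

lemma dist_add_add_le_conv (K K' L L' : Conv n) :
    dist (K + L) (K' + L') ≤ dist K K' + dist L L' := by
  have key : ∀ K K' L L' : Conv n, ∀ z ∈ K + L, ∃ w ∈ K' + L', dist z w ≤ dist K K' + dist L L' := by
    intro K K' L L' z hz
    obtain ⟨x, hx, y, hy, rfl⟩ := mem_add_iff.1 hz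
    obtain ⟨x', hx', h1⟩ := exists_mem_dist_le (L := K') hx
    obtain ⟨y', hy', h2⟩ := exists_mem_dist_le (L := L') hy
    exact ⟨x' + y', mem_add_iff.2 ⟨x', hx', y', hy', rfl⟩,
      (dist_add_add_le _ _ _ _).trans (add_le_add h1 h2)⟩
  refine dist_le_of_exists (add_nonneg dist_nonneg dist_nonneg) (key _ _ _ _) ?_
  rw [dist_comm K, dist_comm L]
  exact key _ _ _ _

instance : ContinuousAdd (Conv n) where
  continuous_add := by
    refine continuous_iff_continuousAt.2 fun q => ?_
    rw [ContinuousAt, tendsto_iff_dist_tendsto_zero]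
    refine squeeze_zero (fun _ => dist_nonneg)
      (fun x => dist_add_add_le_conv x.1 q.1 x.2 q.2) ?_
    have : Continuous fun x : Conv n × Conv n => dist x.1 q.1 + dist x.2 q.2 := by fun_prop
    simpa using this.tendsto q

lemma continuous_mixedVol (m : ℕ) (u : Conv n) : Continuous fun v => mixedVol m u v := by
  unfold mixedVol mixedVolume
  refine continuous_const.mul (continuous_finsetSum _ fun S _ => continuous_const.mul
    (continuous_vol.comp (continuous_finsetSum _ fun i _ => ?_)))
  by_cases h : (i : ℕ) + m < n
  · simpa [h] using continuous_const
  · simpa [h] using continuous_id'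

lemma tendsto_add_smul_unitBall (K : Conv n) :
    Tendsto (fun ε : ℝ => K + ε • unitBall n) (𝓝[≥] 0) (𝓝 K) := by
  rw [tendsto_iff_dist_tendsto_zero]
  have h : Tendsto (fun ε : ℝ => ε) (𝓝[≥] 0) (𝓝 0) := nhdsWithin_le_nhds
  refine squeeze_zero' (Eventually.of_forall fun _ => dist_nonneg) ?_ h
  filter_upwards [self_mem_nhdsWithin] with ε hε
  have hε : 0 ≤ ε := hε
  refine dist_le_of_exists hε (fun z hz => ?_) fun x hx => ?_
  · obtain ⟨x, hx, y, hy, rfl⟩ := mem_add_smul_iff.1 hz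
    refine ⟨x, hx, ?_⟩
    rw [dist_eq_norm, add_sub_cancel_left, norm_smul, Real.norm_of_nonneg hε]
    exact mul_le_of_le_one_right hε (mem_unitBall.1 hy)
  · exact ⟨x, mem_add_smul_iff.2 ⟨x, hx, 0, mem_unitBall.2 (by simp), by simp⟩, by simpa using hε⟩

/-! ### Support functions -/

lemma bddAbove_supp (K : Conv n) (p : EuclideanSpace ℝ (Fin n)) :
    BddAbove ((fun x : EuclideanSpace ℝ (Fin n) => (inner ℝ x p : ℝ)) '' K) :=
  (K.isCompact.image (by fun_prop)).bddAbove

lemma inner_le_supp {K : Conv n} {x : EuclideanSpace ℝ (Fin n)} (hx : x ∈ K)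
    (p : EuclideanSpace ℝ (Fin n)) : (inner ℝ x p : ℝ) ≤ supp K p :=
  le_csSup (bddAbove_supp K p) (mem_image_of_mem _ hx)

lemma supp_le {K : Conv n} {p : EuclideanSpace ℝ (Fin n)} {r : ℝ}
    (h : ∀ x ∈ K, (inner ℝ x p : ℝ) ≤ r) : supp K p ≤ r :=
  csSup_le (K.nonempty.image _) (by rintro _ ⟨x, hx, rfl⟩; exact h x hx)

lemma exists_inner_eq_supp (K : Conv n) (p : EuclideanSpace ℝ (Fin n)) :
    ∃ x ∈ K, (inner ℝ x p : ℝ) = supp K p := by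
  obtain ⟨x, hx, h⟩ := (K.isCompact.image (f := fun x : EuclideanSpace ℝ (Fin n) =>
    (inner ℝ x p : ℝ)) (by fun_prop)).sSup_mem (K.nonempty.image _)
  exact ⟨x, hx, h⟩

lemma supp_mono {K L : Conv n} (h : K ≤ L) (p : EuclideanSpace ℝ (Fin n)) :
    supp K p ≤ supp L p := supp_le fun _ hx => inner_le_supp (h hx) p

lemma supp_add_smul (K L : Conv n) {h : ℝ} (hh : 0 ≤ h) (p : EuclideanSpace ℝ (Fin n)) :
    supp (K + h • L) p = supp K p + h * supp L p := by
  apply le_antisymm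
  · refine supp_le fun z hz => ?_
    obtain ⟨x, hx, y, hy, rfl⟩ := mem_add_smul_iff.1 hz
    rw [inner_add_left, inner_smul_left, conj_trivial]
    exact add_le_add (inner_le_supp hx p) (mul_le_mul_of_nonneg_left (inner_le_supp hy p) hh)
  · obtain ⟨x, hx, h1⟩ := exists_inner_eq_supp K p
    obtain ⟨y, hy, h2⟩ := exists_inner_eq_supp L p
    rw [← h1, ← h2]
    have := inner_le_supp (mem_add_smul_iff.2 ⟨x, hx, y, hy, rfl⟩ : x + h • y ∈ K + h • L) p
    rwa [inner_add_left, inner_smul_left, conj_trivial] at this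

lemma supp_unitBall_le (p : EuclideanSpace ℝ (Fin n)) : supp (unitBall n) p ≤ ‖p‖ :=
  supp_le fun x hx => (real_inner_le_norm x p).trans
    (mul_le_of_le_one_left (norm_nonneg p) (mem_unitBall.1 hx))

/-- A point of K outside L would be separated from L by a hyperplane, whose normal p violates the
hypothesis. -/
lemma le_of_supp_le {K L : Conv n} (h : ∀ p, supp K p ≤ supp L p) : K ≤ L := by
  intro x hx
  by_contra hxL
  obtain ⟨f, s, hs, hx'⟩ := geometric_hahn_banach_closed_point L.convex L.isClosed hxL
  let p := (InnerProductSpace.toDual ℝ (EuclideanSpace ℝ (Fin n))).symm f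
  have hf : ∀ y, (inner ℝ y p : ℝ) = f y := fun y => by
    rw [real_inner_comm, InnerProductSpace.toDual_symm_apply]
  have h1 : supp L p ≤ s := supp_le fun y hy => by rw [hf]; exact (hs y hy).le
  have h2 := inner_le_supp hx p
  rw [hf] at h2
  linarith [h p]

lemma dist_supp_le (K L : Conv n) (p : EuclideanSpace ℝ (Fin n)) :
    dist (supp K p) (supp L p) ≤ ‖p‖ * dist K L := by
  have key : ∀ K L : Conv n, supp K p ≤ supp L p + ‖p‖ * dist K L := by
    intro K L
    have h1 := supp_mono (le_add_smul_unitBall (le_refl (dist K L))) p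
    rw [supp_add_smul _ _ dist_nonneg] at h1
    have h2 := mul_le_mul_of_nonneg_left (supp_unitBall_le p) (dist_nonneg (x := K) (y := L))
    linarith
  rw [Real.dist_eq, abs_le]
  have h1 := key K L
  have h2 := key L K
  rw [dist_comm L K] at h2
  constructor <;> linarith

lemma continuous_supp (p : EuclideanSpace ℝ (Fin n)) : Continuous fun K : Conv n => supp K p :=
  (LipschitzWith.of_dist_le_mul (K := ‖p‖₊) fun K L => dist_supp_le K L p).continuous

/-! ### Linear images -/

lemma vol_linImage (T : EuclideanSpace ℝ (Fin n) →L[ℝ] EuclideanSpace ℝ (Fin n)) (K : Conv n) :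
    vol (linImage T K) = |T.det| * vol K := by
  unfold vol
  have : ((linImage T K : Conv n) : Set (EuclideanSpace ℝ (Fin n))) = T '' K := rfl
  rw [this, Measure.addHaar_image_continuousLinearMap, ENNReal.toReal_mul,
    ENNReal.toReal_ofReal (abs_nonneg _)]

lemma linImage_add_smul (T : EuclideanSpace ℝ (Fin n) →L[ℝ] EuclideanSpace ℝ (Fin n))
    (K L : Conv n) (h : ℝ) : linImage T (K + h • L) = linImage T K + h • linImage T L := by
  ext z
  rw [SetLike.mem_coe, SetLike.mem_coe, mem_add_smul_iff]
  constructor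
  · rintro ⟨w, hw, rfl⟩
    obtain ⟨x, hx, y, hy, rfl⟩ := mem_add_smul_iff.1 hw
    exact ⟨T x, ⟨x, hx, rfl⟩, T y, ⟨y, hy, rfl⟩, by simp⟩
  · rintro ⟨_, ⟨x, hx, rfl⟩, _, ⟨y, hy, rfl⟩, rfl⟩
    exact ⟨x + h • y, mem_add_smul_iff.2 ⟨x, hx, y, hy, rfl⟩, by simp⟩

lemma continuous_linImage : Continuous fun q : (EuclideanSpace ℝ (Fin n) →L[ℝ]
    EuclideanSpace ℝ (Fin n)) × Conv n => linImage q.1 q.2 := by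
  refine continuous_iff_continuousAt.2 fun ⟨T₀, K₀⟩ => ?_
  obtain ⟨R, hR0, hR⟩ := K₀.isBounded.exists_pos_norm_le
  rw [ContinuousAt, tendsto_iff_dist_tendsto_zero]
  have hb : Continuous fun q : (EuclideanSpace ℝ (Fin n) →L[ℝ] EuclideanSpace ℝ (Fin n)) × Conv n =>
      ‖q.1‖ * dist q.2 K₀ + ‖q.1 - T₀‖ * R := by fun_prop
  have hb0 := hb.tendsto (T₀, K₀)
  simp only [dist_self, sub_self, norm_zero, mul_zero, zero_mul, add_zero] at hb0
  refine squeeze_zero (fun _ => dist_nonneg) (fun q => ?_) hb0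
  obtain ⟨T, K⟩ := q
  have key : ∀ x, ∀ y ∈ K₀, dist x y ≤ dist K K₀ →
      dist (T x) (T₀ y) ≤ ‖T‖ * dist K K₀ + ‖T - T₀‖ * R := by
    intro x y hy hxy
    have e : T x - T₀ y = T (x - y) + (T - T₀) y := by simp
    rw [dist_eq_norm, e]
    refine (norm_add_le _ _).trans (add_le_add ?_ ?_)
    · refine (T.le_opNorm _).trans (mul_le_mul_of_nonneg_left ?_ (norm_nonneg _))
      rwa [← dist_eq_norm]
    · exact ((T - T₀).le_opNorm _).trans (mul_le_mul_of_nonneg_left (hR y hy) (norm_nonneg _))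
  refine dist_le_of_exists (by positivity) ?_ ?_
  · rintro _ ⟨x, hx, rfl⟩
    obtain ⟨y, hy, hxy⟩ := exists_mem_dist_le (L := K₀) hx
    exact ⟨T₀ y, ⟨y, hy, rfl⟩, key x y hy hxy⟩
  · rintro _ ⟨y, hy, rfl⟩
    obtain ⟨x, hx, hxy⟩ := exists_mem_dist_le (L := K) hy
    rw [dist_comm, dist_comm K₀] at hxy
    exact ⟨T x, ⟨x, hx, rfl⟩, by rw [dist_comm]; exact key x y hy hxy⟩

lemma expFlow_eq_linImage (A : EuclideanSpace ℝ (Fin n) →L[ℝ] EuclideanSpace ℝ (Fin n)) (c : ℝ)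
    (K : Conv n) : expFlow A c K = linImage (opExp A c) K := rfl

lemma continuous_expFlow (A : EuclideanSpace ℝ (Fin n) →L[ℝ] EuclideanSpace ℝ (Fin n)) :
    Continuous fun q : ℝ × Conv n => expFlow A q.1 q.2 :=
  continuous_linImage.comp (((continuous_opExp A).comp continuous_fst).prodMk continuous_snd)

lemma linImage_comp (S T : EuclideanSpace ℝ (Fin n) →L[ℝ] EuclideanSpace ℝ (Fin n)) (K : Conv n) :
    linImage S (linImage T K) = linImage (S.comp T) K :=
  SetLike.ext' (image_image S T K)

lemma linImage_id (K : Conv n) : linImage (ContinuousLinearMap.id ℝ _) K = K :=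
  SetLike.ext' (image_id _)

lemma linImage_mono (T : EuclideanSpace ℝ (Fin n) →L[ℝ] EuclideanSpace ℝ (Fin n)) {K L : Conv n}
    (h : K ≤ L) : linImage T K ≤ linImage T L := by
  rintro _ ⟨x, hx, rfl⟩
  exact ⟨x, h hx, rfl⟩

lemma expFlow_zero (A : EuclideanSpace ℝ (Fin n) →L[ℝ] EuclideanSpace ℝ (Fin n)) (K : Conv n) :
    expFlow A 0 K = K := by
  rw [expFlow_eq_linImage, opExp_zero, linImage_id]

lemma expFlow_expFlow_neg (A : EuclideanSpace ℝ (Fin n) →L[ℝ] EuclideanSpace ℝ (Fin n)) (c : ℝ)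
    (K : Conv n) : expFlow A c (expFlow A (-c) K) = K := by
  rw [expFlow_eq_linImage, expFlow_eq_linImage, linImage_comp, opExp_comp_neg, linImage_id]

end ConvexBodies

/-! ### The first mixed volume as a derivative of the volume -/

section MixedVolume

variable {n : ℕ}

lemma exists_polynomial_vol_add_smul (u w : Conv n) :
    ∃ P : Polynomial ℝ, P.natDegree ≤ n ∧ ∀ h : ℝ, 0 ≤ h → vol (u + h • w) = P.eval h := by
  refine ⟨∑ i ∈ Finset.range (n + 1),
    lagrangeWeight n i * Polynomial.C (vol (u + ((i : ℝ) + 1) • w)), ?_, fun h hh => ?_⟩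
  · refine Polynomial.natDegree_sum_le_of_forall_le _ _ fun i hi => ?_
    exact (Polynomial.natDegree_mul_C_le _ _).trans (natDegree_lagrangeWeight hi).le
  · rw [vol_add_smul_eq_sum u w hh, Polynomial.eval_finsetSum]
    simp

lemma smul_smul_conv (K : Conv n) (a b : ℝ) : a • b • K = (a * b) • K := (mul_smul a b K).symm

/-- Homogeneity, mu + w = m(u + m⁻¹w), reverses the coefficients of P; the case m = 0 is a limit
from the right. -/
lemma vol_smul_add (u w : Conv n) {P : Polynomial ℝ} (hdeg : P.natDegree ≤ n)
    (hP : ∀ h : ℝ, 0 ≤ h → vol (u + h • w) = P.eval h) {m : ℝ} (hm : 0 ≤ m) :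
    vol (m • u + w) = ∑ j ∈ Finset.range (n + 1), P.coeff j * m ^ (n - j) := by
  have hpos : ∀ {m : ℝ}, 0 < m →
      vol (m • u + w) = ∑ j ∈ Finset.range (n + 1), P.coeff j * m ^ (n - j) := by
    intro m hm
    have e : m • u + w = m • (u + m⁻¹ • w) := by
      rw [smul_add, smul_smul_conv, mul_inv_cancel₀ hm.ne', one_smul]
    rw [e, vol_smul _ hm.le, hP _ (inv_nonneg.2 hm.le),
      Polynomial.eval_eq_sum_range' (Nat.lt_succ_of_le hdeg), Finset.mul_sum]
    refine Finset.sum_congr rfl fun j hj => ?_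
    have hj : j ≤ n := Nat.lt_succ_iff.1 (Finset.mem_range.1 hj)
    obtain ⟨l, rfl⟩ := Nat.exists_eq_add_of_le hj
    rw [Nat.add_sub_cancel_left, pow_add, inv_pow]
    field_simp
  rcases hm.eq_or_lt with rfl | hm
  · have h1 := (tendsto_vol_add_smul w u).mono_left (nhdsWithin_mono 0 Ioi_subset_Ici_self)
    have hc : Continuous fun m : ℝ =>
      ∑ j ∈ Finset.range (n + 1), P.coeff j * m ^ (n - j) := by fun_prop
    have h2 := (hc.tendsto 0).mono_left (nhdsWithin_le_nhds (s := Ioi 0))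
    have h3 : (fun m : ℝ => vol (w + m • u)) =ᶠ[𝓝[>] 0] fun m : ℝ =>
        ∑ j ∈ Finset.range (n + 1), P.coeff j * m ^ (n - j) := by
      filter_upwards [self_mem_nhdsWithin] with m hm
      rw [add_comm]
      exact hpos hm
    rw [zero_smul_conv, zero_add]
    exact tendsto_nhds_unique (h1.congr' h3) h2
  · exact hpos hm

/-- The alternating sum defining a mixed volume `V[u, …, u, w]`, grouped by cardinalities. -/
lemma sum_neg_one_pow_card_mul_vol {N : ℕ} (u w : Conv (N + 1)) :
    ∑ S : Finset (Fin (N + 1)), (-1 : ℝ) ^ (N + 1 - S.card) *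
        vol (∑ i ∈ S, if (i : ℕ) + 1 < N + 1 then u else w) =
      ∑ m ∈ Finset.range (N + 1), ((-1 : ℤ) ^ (N - m) * (N.choose m : ℤ)) •
        (vol ((m : ℝ) • u + w) - vol ((m : ℝ) • u)) := by
  set s : Finset (Fin (N + 1)) := Finset.univ.map Fin.castSuccEmb with hs
  have hlast : Fin.last N ∉ s := by
    simp only [hs, Finset.mem_map, Finset.mem_univ, true_and, not_exists]
    intro i
    exact Fin.castSucc_ne_last i
  have huniv : (Finset.univ : Finset (Finset (Fin (N + 1)))) =
      (insert (Fin.last N) s).powerset := by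
    have : insert (Fin.last N) s = Finset.univ := by
      ext i
      refine ⟨fun _ => Finset.mem_univ i, fun _ => ?_⟩
      induction i using Fin.lastCases with
      | last => exact Finset.mem_insert_self _ _
      | cast i => exact Finset.mem_insert_of_mem (Finset.mem_map_of_mem Fin.castSuccEmb
          (Finset.mem_univ i))
    rw [this, Finset.powerset_univ]
  have hcard : s.card = N := by simp [hs]
  have hsum : ∀ t ∈ s.powerset, (∑ i ∈ t, if (i : ℕ) + 1 < N + 1 then u else w) =
      ((t.card : ℕ) : ℝ) • u := by
    intro t ht
    have hmem : ∀ i ∈ t, (if (i : ℕ) + 1 < N + 1 then u else w) = u := by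
      intro i hi
      obtain ⟨j, -, rfl⟩ := Finset.mem_map.1 (Finset.mem_powerset.1 ht hi)
      simp
    rw [Finset.sum_congr rfl hmem, Finset.sum_const]
    generalize t.card = c
    induction c with
    | zero => simp [zero_smul_conv]
    | succ c ih =>
      rw [succ_nsmul, ih, Nat.cast_succ, add_smul_conv u (Nat.cast_nonneg c) zero_le_one, one_smul]
  -- Only the last place holds w. Subsets are split by whether they contain it; each summand then
  -- depends on the cardinality alone.
  rw [huniv, Finset.sum_powerset_insert hlast]
  have e1 : ∑ t ∈ s.powerset, (-1 : ℝ) ^ (N + 1 - t.card) *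
        vol (∑ i ∈ t, if (i : ℕ) + 1 < N + 1 then u else w) =
      ∑ t ∈ s.powerset, (fun c : ℕ => (-1 : ℝ) ^ (N + 1 - c) * vol ((c : ℝ) • u)) t.card :=
    Finset.sum_congr rfl fun t ht => by rw [hsum t ht]
  have e2 : ∑ t ∈ s.powerset, (-1 : ℝ) ^ (N + 1 - (insert (Fin.last N) t).card) *
        vol (∑ i ∈ insert (Fin.last N) t, if (i : ℕ) + 1 < N + 1 then u else w) =
      ∑ t ∈ s.powerset, (fun c : ℕ => (-1 : ℝ) ^ (N - c) * vol ((c : ℝ) • u + w)) t.card := by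
    refine Finset.sum_congr rfl fun t ht => ?_
    have hnot : Fin.last N ∉ t := fun h => hlast (Finset.mem_powerset.1 ht h)
    rw [Finset.sum_insert hnot, hsum t ht, Finset.card_insert_of_notMem hnot, Nat.add_sub_add_right]
    simp [add_comm]
  rw [e1, e2, Finset.sum_powerset_apply_card (fun c : ℕ => (-1 : ℝ) ^ (N + 1 - c) * vol ((c : ℝ) • u)),
    Finset.sum_powerset_apply_card (fun c : ℕ => (-1 : ℝ) ^ (N - c) * vol ((c : ℝ) • u + w)), hcard,
    ← Finset.sum_add_distrib]
  refine Finset.sum_congr rfl fun m hm => ?_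
  have hm : m ≤ N := Nat.lt_succ_iff.1 (Finset.mem_range.1 hm)
  rw [Nat.succ_sub hm, pow_succ]
  simp only [nsmul_eq_mul, zsmul_eq_mul]
  push_cast
  ring

/-- The sum is the N-th forward difference at 0 of a polynomial in m of degree at most N, so it
equals N! times the coefficient of m^N. That coefficient is the linear one of P, by the reversal in
`vol_smul_add`. -/
lemma sum_choose_mul_vol_sub {N : ℕ} (u w : Conv (N + 1)) {P : Polynomial ℝ}
    (hdeg : P.natDegree ≤ N + 1) (hP : ∀ h : ℝ, 0 ≤ h → vol (u + h • w) = P.eval h) :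
    ∑ m ∈ Finset.range (N + 1), ((-1 : ℤ) ^ (N - m) * (N.choose m : ℤ)) •
      (vol ((m : ℝ) • u + w) - vol ((m : ℝ) • u)) = N.factorial * P.coeff 1 := by
  -- The term P.coeff 0 · m^(N+1) is absent: it equals V[mu] and cancels.
  let R : ℝ → ℝ := P.coeff 1 • (fun r : ℝ => r ^ N) +
    fun r => ∑ j ∈ Finset.range N, P.coeff (N + 1 - j) * r ^ j
  have hR : ∀ m : ℕ, vol ((m : ℝ) • u + w) - vol ((m : ℝ) • u) = R m := by
    intro m
    have h0 : vol u = P.coeff 0 := by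
      have := hP 0 le_rfl
      rwa [zero_smul_conv, add_zero, ← Polynomial.coeff_zero_eq_eval_zero] at this
    rw [vol_smul_add u w hdeg hP (Nat.cast_nonneg m), vol_smul _ (Nat.cast_nonneg m), h0,
      Finset.sum_range_succ', Finset.sum_range_succ']
    simp only [R, Pi.add_apply, Pi.smul_apply, smul_eq_mul]
    rw [← Finset.sum_range_reflect (fun j => P.coeff (N + 1 - j) * (m : ℝ) ^ j)]
    have : ∀ j ∈ Finset.range N, P.coeff (j + 1 + 1) * (m : ℝ) ^ (N + 1 - (j + 1 + 1)) =
        P.coeff (N + 1 - (N - 1 - j)) * (m : ℝ) ^ (N - 1 - j) := by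
      intro j hj
      have hj := Finset.mem_range.1 hj
      congr 2 <;> omega
    rw [Finset.sum_congr rfl this]
    simp only [Nat.zero_add, Nat.add_sub_cancel, Nat.sub_zero]
    ring
  have h1 := fwdDiff_iter_eq_sum_shift (1 : ℝ) R N 0
  have h2 : (fwdDiff (1 : ℝ))^[N] R 0 = N.factorial * P.coeff 1 := by
    rw [fwdDiff_iter_add, fwdDiff_iter_const_smul, fwdDiff_iter_eq_factorial,
      fwdDiff_iter_sum_mul_pow_eq_zero]
    simp [mul_comm]
  rw [← h2, h1]
  exact Finset.sum_congr rfl fun m _ => by rw [hR]; simp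

/-- The one-sided derivative of the volume at `u` in the direction `w` is `n V₁[u, w]`. -/
theorem hasDerivWithinAt_vol_add_smul (hn : 1 ≤ n) (u w : Conv n) :
    HasDerivWithinAt (fun h : ℝ => vol (u + h • w)) (n * mixedVol 1 u w) (Ici 0) 0 := by
  obtain ⟨N, rfl⟩ := Nat.exists_eq_add_of_le' hn
  obtain ⟨P, hdeg, hP⟩ := exists_polynomial_vol_add_smul u w
  have h1 : ((N + 1 : ℕ) : ℝ) * mixedVol 1 u w = P.derivative.eval 0 := by
    unfold mixedVol mixedVolume
    rw [sum_neg_one_pow_card_mul_vol, sum_choose_mul_vol_sub u w hdeg hP,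
      ← Polynomial.coeff_zero_eq_eval_zero, Polynomial.coeff_derivative, Nat.factorial_succ]
    have := Nat.factorial_ne_zero N
    push_cast
    field_simp
    simp
  rw [h1]
  exact (P.hasDerivAt 0).hasDerivWithinAt.congr (fun h hh => hP h hh) (hP 0 le_rfl)

end MixedVolume

/-! ### The upper right derivative of the volume along a solution -/

section VolumeDerivative

variable {n : ℕ}

lemma supp_linImage_add_smul (T : EuclideanSpace ℝ (Fin n) →L[ℝ] EuclideanSpace ℝ (Fin n))
    (K L : Conv n) {h : ℝ} (hh : 0 ≤ h) (p : EuclideanSpace ℝ (Fin n)) :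
    supp (linImage T (K + h • L)) p = supp (linImage T K) p + h * supp (linImage T L) p := by
  rw [linImage_add_smul, supp_add_smul _ _ hh]

lemma hasDerivWithinAt_abs_det_opExp_mul
    (A : EuclideanSpace ℝ (Fin n) →L[ℝ] EuclideanSpace ℝ (Fin n)) {c : ℝ → ℝ} {c' : ℝ}
    (hc0 : c 0 = 0) (hc : HasDerivAt c c' 0) {g : ℝ → ℝ} {g' : ℝ}
    (hg : HasDerivWithinAt g g' (Ici 0) 0) :
    HasDerivWithinAt (fun h => |(opExp A (c h)).det| * g h)
      (LinearMap.trace ℝ _ A.toLinearMap * c' * g 0 + g') (Ici 0) 0 := by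
  have h1 : HasDerivAt (fun h => (opExp A (c h)).det)
      (LinearMap.trace ℝ _ A.toLinearMap * c') 0 :=
    HasDerivAt.comp_of_eq (0 : ℝ) (hasDerivAt_det_opExp A) hc hc0.symm
  have hd0 : (opExp A (c 0)).det = 1 := by
    rw [hc0, opExp_zero]; simp [ContinuousLinearMap.det]
  have h2 : ∀ᶠ h in 𝓝 (0 : ℝ), 0 < (opExp A (c h)).det :=
    h1.continuousAt.eventually (lt_mem_nhds (by simp only [hd0]; exact one_pos))
  have h3 := (h1.hasDerivWithinAt (s := Ici 0)).mul hg
  rw [hd0, one_mul] at h3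
  refine h3.congr_of_eventuallyEq ?_ (by simp [hd0])
  filter_upwards [h2.filter_mono nhdsWithin_le_nhds] with h hh
  simp [abs_of_pos hh]

/-- The upper right derivative of the volume along a solution of the integral equation is at most
`tr A φ(V) V + n V₁[u, F(V, u)]`. -/
theorem eventually_slope_vol_lt (hn : 1 ≤ n)
    {A : EuclideanSpace ℝ (Fin n) →L[ℝ] EuclideanSpace ℝ (Fin n)} {φ : ℝ → ℝ}
    (hφ : ContinuousOn φ (Ici 0)) {F : ℝ → Conv n → Conv n}
    (hF : ContinuousOn (fun q : ℝ × Conv n => F q.1 q.2) (Ici (0 : ℝ) ×ˢ univ))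
    {u₀ : Conv n} {U : ℝ → Conv n} (hU0 : U 0 = u₀) (hU : SolvesIntegralEq A φ F u₀ U) {r : ℝ}
    (hr : LinearMap.trace ℝ _ A.toLinearMap * φ (vol u₀) * vol u₀ +
      n * mixedVol 1 u₀ (F (vol u₀) u₀) < r) :
    ∀ᶠ h in 𝓝[>] (0 : ℝ), slope (fun h => vol (U h)) 0 h < r := by
  obtain ⟨hUc, hUeq⟩ := hU
  set F₀ := F (vol u₀) u₀ with hF₀
  set B := unitBall n
  -- Enlarging F₀ by εB absorbs the variation of the integrand over short times; continuity of the
  -- mixed volume keeps the bound below r.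
  obtain ⟨ε, hεr, hε⟩ : ∃ ε : ℝ, LinearMap.trace ℝ _ A.toLinearMap * φ (vol u₀) * vol u₀ +
      n * mixedVol 1 u₀ (F₀ + ε • B) < r ∧ 0 < ε := by
    have h1 : Tendsto (fun ε : ℝ => LinearMap.trace ℝ _ A.toLinearMap * φ (vol u₀) * vol u₀ +
        n * mixedVol 1 u₀ (F₀ + ε • B)) (𝓝[>] 0) (𝓝 (LinearMap.trace ℝ _ A.toLinearMap *
          φ (vol u₀) * vol u₀ + n * mixedVol 1 u₀ F₀)) :=
      ((((continuous_mixedVol 1 u₀).tendsto F₀).comp ((tendsto_add_smul_unitBall F₀).mono_left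
        (nhdsWithin_mono 0 Ioi_subset_Ici_self))).const_mul _).const_add _
    exact ((h1.eventually (gt_mem_nhds hr)).and self_mem_nhdsWithin).exists
  let Ũ : ℝ → Conv n := fun s => U (max s 0)
  have hŨ : Continuous Ũ := hUc.comp_continuous (by fun_prop) fun s => le_max_right s 0
  have hŨ0 : Ũ 0 = u₀ := by simp [Ũ, hU0]
  have hŨs : ∀ {s : ℝ}, 0 ≤ s → Ũ s = U s := fun hs => by simp [Ũ, max_eq_left hs]
  let a : ℝ → ℝ := fun s => φ (vol (Ũ s))
  have ha : Continuous a := hφ.comp_continuous (continuous_vol.comp hŨ) fun s => vol_nonneg _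
  let f : ℝ → Conv n := fun s => F (vol (Ũ s)) (Ũ s)
  have hf : Continuous f := hF.comp_continuous ((continuous_vol.comp hŨ).prodMk hŨ)
    fun s => ⟨vol_nonneg _, mem_univ _⟩
  let c : ℝ → ℝ := fun h => ∫ s in (0 : ℝ)..h, a s
  have hcd : ∀ h, HasDerivAt c (a h) h := fun h => ha.integral_hasStrictDerivAt 0 h |>.hasDerivAt
  have hc : Continuous c := continuous_iff_continuousAt.2 fun h => (hcd h).continuousAt
  have hc0 : c 0 = 0 := by simp [c]
  -- The integrand at time s of the equation for u(h), with the factor e^{c(h)A} taken out. It is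
  -- jointly continuous with value F₀ at the origin, hence inside F₀ + εB nearby.
  let K : ℝ × ℝ → Conv n := fun q => expFlow A (-c q.2) (expFlow A (c q.2 - c q.1) (f q.1))
  have hK : Continuous K := by
    have h1 : Continuous fun q : ℝ × ℝ => expFlow A (c q.2 - c q.1) (f q.1) :=
      (continuous_expFlow A).comp (((hc.comp continuous_snd).sub (hc.comp continuous_fst)).prodMk
        (hf.comp continuous_fst))
    exact (continuous_expFlow A).comp ((hc.comp continuous_snd).neg.prodMk h1)
  have hK0 : K (0, 0) = F₀ := by
    simp only [K, hc0, sub_zero, neg_zero, expFlow_zero, f, hŨ0, hF₀]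
  obtain ⟨δ, hδ, hball⟩ := Metric.continuousAt_iff.1 (hK.continuousAt (x := (0, 0))) ε hε
  have hKle : ∀ s h : ℝ, |s| < δ → |h| < δ → K (s, h) ≤ F₀ + ε • B := by
    intro s h hs hh
    refine le_add_smul_unitBall ?_
    rw [← hK0]
    refine (hball ?_).le
    rw [Prod.dist_eq]
    simpa using ⟨hs, hh⟩
  have hUle : ∀ h : ℝ, 0 ≤ h → h < δ →
      U h ≤ linImage (opExp A (c h)) (u₀ + h • (F₀ + ε • B)) := by
    intro h hh hhδ
    -- Inclusion is tested on support functions, where the integral equation is scalar and its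
    -- integrand can be bounded pointwise.
    refine le_of_supp_le fun p => ?_
    rw [supp_linImage_add_smul _ _ _ hh, hUeq h hh p]
    have e1 : ∀ s ∈ Icc 0 h, ∫ τ in s..h, φ (vol (U τ)) = c h - c s := by
      intro s hs
      simp only [c]
      rw [intervalIntegral.integral_interval_sub_left (ha.intervalIntegrable _ _)
        (ha.intervalIntegrable _ _)]
      refine intervalIntegral.integral_congr fun τ hτ => ?_
      rw [uIcc_of_le hs.2] at hτ
      simp only [a, hŨs (hs.1.trans hτ.1)]
    have e2 : ∫ s in (0 : ℝ)..h,
        supp (expFlow A (∫ τ in s..h, φ (vol (U τ))) (F (vol (U s)) (U s))) p =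
        ∫ s in (0 : ℝ)..h, supp (expFlow A (c h - c s) (f s)) p := by
      refine intervalIntegral.integral_congr fun s hs => ?_
      rw [uIcc_of_le hh] at hs
      simp only [e1 s hs, f, hŨs hs.1]
    have e0 : ∫ s in (0 : ℝ)..h, φ (vol (U s)) = c h := by
      rw [e1 0 (left_mem_Icc.2 hh), hc0, sub_zero]
    rw [e0, e2, expFlow_eq_linImage]
    gcongr
    have hcont : Continuous fun s => supp (expFlow A (c h - c s) (f s)) p :=
      (continuous_supp p).comp ((continuous_expFlow A).comp ((continuous_const.sub hc).prodMk hf))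
    calc ∫ s in (0 : ℝ)..h, supp (expFlow A (c h - c s) (f s)) p
        ≤ ∫ _ in (0 : ℝ)..h, supp (linImage (opExp A (c h)) (F₀ + ε • B)) p := by
          refine intervalIntegral.integral_mono_on hh (hcont.intervalIntegrable _ _)
            (continuous_const.intervalIntegrable _ _) fun s hs => supp_mono ?_ p
          have h1 := linImage_mono (opExp A (c h)) (hKle s h
            (by rw [abs_of_nonneg hs.1]; exact hs.2.trans_lt hhδ) (by rwa [abs_of_nonneg hh]))
          rw [← expFlow_eq_linImage A] at h1
          simp only [K, expFlow_expFlow_neg] at h1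
          exact h1
      _ = h * supp (linImage (opExp A (c h)) (F₀ + ε • B)) p := by simp
  let g : ℝ → ℝ := fun h => |(opExp A (c h)).det| * vol (u₀ + h • (F₀ + ε • B))
  have hg : HasDerivWithinAt g _ (Ici 0) 0 := hasDerivWithinAt_abs_det_opExp_mul A hc0 (hcd 0)
    (hasDerivWithinAt_vol_add_smul hn u₀ (F₀ + ε • B))
  rw [zero_smul_conv, add_zero] at hg
  have ha0 : a 0 = φ (vol u₀) := by simp [a, hŨ0]
  rw [ha0] at hg
  have hslope := (hasDerivWithinAt_iff_tendsto_slope' self_notMem_Ioi).1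
    hg.Ioi_of_Ici
  have hg0 : g 0 = vol u₀ := by
    simp [g, hc0, opExp_zero, zero_smul_conv, ContinuousLinearMap.det]
  filter_upwards [hslope (gt_mem_nhds hεr), self_mem_nhdsWithin,
    nhdsWithin_le_nhds (gt_mem_nhds hδ)] with h h1 h2 h3
  have h2 : 0 < h := h2
  refine lt_of_le_of_lt ?_ h1
  have h4 : vol (U h) ≤ g h := by
    simp only [g]
    rw [← vol_linImage]
    exact vol_mono (hUle h h2.le h3)
  rw [slope_def_field, slope_def_field, hU0, hg0]
  gcongr

end VolumeDerivative

/-! ### Peano's theorem by delayed equations -/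

section Peano

variable {E : Type*} [NormedAddCommGroup E] [NormedSpace ℝ E] [FiniteDimensional ℝ E]

/-- Iterates of the delayed integral operator. After `j` steps they solve the equation
`x(t) = x₀ + ∫₀ᵗ G(s, x(s - δ)) ds` on `[0, jδ]`. -/
noncomputable def delayIterate (G : ℝ → E → E) (x₀ : E) (δ : ℝ) : ℕ → ℝ → E
  | 0 => fun _ => x₀
  | j + 1 => fun t => x₀ + ∫ s in (0 : ℝ)..t, G s (delayIterate G x₀ δ j (max (s - δ) 0))

variable {G : ℝ → E → E} {x₀ : E} {δ M : ℝ}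

lemma delayIterate_succ (G : ℝ → E → E) (x₀ : E) (δ : ℝ) (j : ℕ) (t : ℝ) :
    delayIterate G x₀ δ (j + 1) t =
      x₀ + ∫ s in (0 : ℝ)..t, G s (delayIterate G x₀ δ j (max (s - δ) 0)) := rfl

lemma continuous_delayIterate (hG : Continuous fun q : ℝ × E => G q.1 q.2) (j : ℕ) :
    Continuous (delayIterate G x₀ δ j) := by
  have : CompleteSpace E := FiniteDimensional.complete ℝ E
  induction j with
  | zero => exact continuous_const
  | succ j ih =>
    have hc : Continuous fun s => G s (delayIterate G x₀ δ j (max (s - δ) 0)) :=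
      hG.comp (continuous_id.prodMk (ih.comp (by fun_prop)))
    exact continuous_const.add
      (intervalIntegral.continuous_primitive (fun a b => hc.intervalIntegrable a b) 0)

lemma dist_delayIterate_le (hG : Continuous fun q : ℝ × E => G q.1 q.2)
    (hM : ∀ t x, ‖G t x‖ ≤ M) (j : ℕ) (t t' : ℝ) :
    dist (delayIterate G x₀ δ j t) (delayIterate G x₀ δ j t') ≤ M * dist t t' := by
  have hM0 : 0 ≤ M := (norm_nonneg _).trans (hM 0 x₀)
  cases j with
  | zero => simpa [delayIterate] using mul_nonneg hM0 (dist_nonneg (x := t) (y := t'))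
  | succ j =>
    have hc : Continuous fun s => G s (delayIterate G x₀ δ j (max (s - δ) 0)) :=
      hG.comp (continuous_id.prodMk ((continuous_delayIterate hG j).comp (by fun_prop)))
    simp only [delayIterate_succ]
    rw [dist_add_left, dist_eq_norm, intervalIntegral.integral_interval_sub_left
      (hc.intervalIntegrable _ _) (hc.intervalIntegrable _ _)]
    exact intervalIntegral.norm_integral_le_of_norm_le_const fun s _ => hM s _

/-- Each iterate at time t uses the preceding one only up to t - δ, so every iteration extends the
range of agreement by one delay. -/
lemma delayIterate_succ_eq (G : ℝ → E → E) (x₀ : E) (hδ : 0 ≤ δ) (j : ℕ) :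
    ∀ t : ℝ, 0 ≤ t → t ≤ j * δ → delayIterate G x₀ δ (j + 1) t = delayIterate G x₀ δ j t := by
  induction j with
  | zero =>
    intro t h0 h1
    have : t = 0 := le_antisymm (by simpa using h1) h0
    simp [this, delayIterate]
  | succ j ih =>
    intro t h0 h1
    rw [delayIterate_succ G x₀ δ (j + 1) t, delayIterate_succ G x₀ δ j t]
    congr 1
    refine intervalIntegral.integral_congr fun s hs => ?_
    rw [uIcc_of_le h0] at hs
    rw [ih _ (le_max_right _ _)]
    refine max_le ?_ (by positivity)
    push_cast at h1
    linarith [hs.2]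

/-- **Peano's existence theorem** for a bounded continuous right-hand side. -/
theorem exists_integral_eq_of_continuous (hG : Continuous fun q : ℝ × E => G q.1 q.2)
    (hM : ∀ t x, ‖G t x‖ ≤ M) (x₀ : E) {τ : ℝ} (hτ : 0 < τ) :
    ∃ x : ℝ → E, Continuous x ∧ ∀ t ∈ Icc 0 τ, x t = x₀ + ∫ s in (0 : ℝ)..t, G s (x s) := by
  have : CompleteSpace E := FiniteDimensional.complete ℝ E
  have : ProperSpace E := FiniteDimensional.proper ℝ E
  have hM0 : 0 ≤ M := (norm_nonneg _).trans (hM 0 x₀)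
  let d : ℕ → ℝ := fun m => τ / (m + 1)
  have hd : ∀ m, 0 < d m := fun m => by positivity
  have hdτ : ∀ m : ℕ, τ ≤ ((m + 1 : ℕ) : ℝ) * d m := fun m => by
    simp only [d]; push_cast; rw [mul_div_cancel₀]; positivity
  -- With delay τ/(m + 1), iterates m + 1 and m + 2 agree on [0, τ], so the latter solves the
  -- delayed equation there.
  let Y : ℕ → ℝ → E := fun m => delayIterate G x₀ (d m) (m + 2)
  have hYc : ∀ m, Continuous (Y m) := fun m => continuous_delayIterate hG _
  have hYd : ∀ m t t', dist (Y m t) (Y m t') ≤ M * dist t t' := fun m =>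
    dist_delayIterate_le hG hM _
  have hYeq : ∀ m, ∀ t ∈ Icc 0 τ, Y m t = x₀ + ∫ s in (0 : ℝ)..t, G s (Y m (max (s - d m) 0)) := by
    intro m t ht
    change delayIterate G x₀ (d m) (m + 2) t = _
    rw [delayIterate_succ]
    congr 1
    refine intervalIntegral.integral_congr fun s hs => ?_
    rw [uIcc_of_le ht.1] at hs
    simp only [Y]
    rw [delayIterate_succ_eq G x₀ (hd m).le (m + 1) _ (le_max_right _ _)]
    refine max_le ?_ (by positivity)
    linarith [hs.2, ht.2, hd m, hdτ m]
  have hY0 : ∀ m, Y m 0 = x₀ := fun m => by simp [Y, delayIterate]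
  let y : ℕ → BoundedContinuousFunction (Icc (0 : ℝ) τ) E := fun m =>
    BoundedContinuousFunction.mkOfCompact ⟨fun t => Y m t, (hYc m).comp continuous_subtype_val⟩
  have hcomp : IsCompact (closure (range y)) := by
    refine BoundedContinuousFunction.arzela_ascoli (Metric.closedBall x₀ (M * τ))
      (isCompact_closedBall _ _) _ ?_ ?_
    · rintro _ t ⟨m, rfl⟩
      rw [Metric.mem_closedBall]
      calc dist (Y m t) x₀ = dist (Y m t) (Y m 0) := by rw [hY0]
        _ ≤ M * dist (t : ℝ) 0 := hYd m _ _
        _ ≤ M * τ := by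
          gcongr
          rw [Real.dist_eq, sub_zero, abs_of_nonneg t.2.1]
          exact t.2.2
    · refine (LipschitzWith.uniformEquicontinuous _ M.toNNReal ?_).equicontinuous
      rintro ⟨_, m, rfl⟩
      refine LipschitzWith.of_dist_le_mul fun t t' => ?_
      rw [Real.coe_toNNReal M hM0]
      exact hYd m t t'
  obtain ⟨a, -, σ, hσ, ha⟩ := hcomp.tendsto_subseq fun m => subset_closure (mem_range_self m)
  let x : ℝ → E := fun t => a (projIcc 0 τ hτ.le t)
  have hx : Continuous x := a.continuous.comp continuous_projIcc
  have hlim : ∀ t ∈ Icc 0 τ, Tendsto (fun m => Y (σ m) t) atTop (𝓝 (x t)) := by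
    intro t ht
    have h1 := ((BoundedContinuousFunction.lipschitz_eval_const (β := E)
      (⟨t, ht⟩ : Icc (0 : ℝ) τ)).continuous.tendsto a).comp ha
    have h2 : x t = a ⟨t, ht⟩ := by simp only [x]; rw [projIcc_of_mem hτ.le ht]
    rw [h2]
    exact h1
  have hdlim : Tendsto (fun m => d (σ m)) atTop (𝓝 0) := by
    have h : Tendsto d atTop (𝓝 0) := by
      refine ((tendsto_const_div_atTop_nhds_zero_nat τ).comp (tendsto_add_atTop_nat 1)).congr
        fun m => ?_
      simp [d]
    exact h.comp hσ.tendsto_atTop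
  -- The common Lipschitz constant M makes the vanishing delay harmless in the limit.
  have hlim' : ∀ t ∈ Icc 0 τ,
      Tendsto (fun m => Y (σ m) (max (t - d (σ m)) 0)) atTop (𝓝 (x t)) := by
    intro t ht
    refine tendsto_of_tendsto_of_dist (hlim t ht) ?_
    refine squeeze_zero (fun _ => dist_nonneg) (fun m => hYd _ _ _) ?_
    have h1 : Tendsto (fun m => M * dist t (max (t - d (σ m)) 0)) atTop
        (𝓝 (M * dist t (max (t - 0) 0))) :=
      ((tendsto_const_nhds.dist ((tendsto_const_nhds.sub hdlim).max tendsto_const_nhds)).const_mul _)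
    simpa [ht.1] using h1
  refine ⟨x, hx, fun t ht => ?_⟩
  have hint : Tendsto (fun m => ∫ s in (0 : ℝ)..t, G s (Y (σ m) (max (s - d (σ m)) 0))) atTop
      (𝓝 (∫ s in (0 : ℝ)..t, G s (x s))) := by
    refine intervalIntegral.tendsto_integral_filter_of_dominated_convergence (fun _ => M) ?_ ?_ ?_ ?_
    · refine Eventually.of_forall fun m => Continuous.aestronglyMeasurable ?_
      exact hG.comp (continuous_id.prodMk ((hYc _).comp (by fun_prop)))
    · exact Eventually.of_forall fun m => Eventually.of_forall fun s _ => hM _ _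
    · exact intervalIntegrable_const
    · refine Eventually.of_forall fun s hs => ?_
      rw [uIoc_of_le ht.1] at hs
      exact (hG.tendsto (s, x s)).comp
        (tendsto_const_nhds.prodMk_nhds (hlim' s ⟨hs.1.le, hs.2.trans ht.2⟩))
  refine tendsto_nhds_unique (hlim t ht) ?_
  simp_rw [hYeq _ t ht]
  exact hint.const_add x₀

end Peano

/-! ### Comparison of subsolutions with solutions under the Ważewski condition -/

section Comparison

variable {m : ℕ}

/-- `w` is a curve in the cone satisfying the differential inequality `w' ≤ g(w)` on `[0, ∞)` in the
sense of upper right derivatives. -/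
structure IsSubsolution (g : (Fin m → ℝ) → Fin m → ℝ) (w : ℝ → Fin m → ℝ) : Prop where
  continuousOn : ContinuousOn w (Ici 0)
  mem_cone : ∀ t, 0 ≤ t → w t ∈ cone m
  slope_lt : ∀ t, 0 ≤ t → ∀ i, ∀ r, g (w t) i < r → ∀ᶠ z in 𝓝[>] t, slope (fun s => w s i) t z < r

lemma isClosed_cone : IsClosed (cone m) := by
  have : cone m = Ici 0 := by ext x; exact Iff.rfl
  rw [this]; exact isClosed_Ici

variable {g : (Fin m → ℝ) → Fin m → ℝ} {w : ℝ → Fin m → ℝ}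

lemma slope_sub_lt_of_hasDerivAt {u v : ℝ → ℝ} {t a b : ℝ}
    (hu : ∀ r, a < r → ∀ᶠ z in 𝓝[>] t, slope u t z < r) (hv : HasDerivAt v b t) {r : ℝ}
    (hr : a - b < r) : ∀ᶠ z in 𝓝[>] t, slope (fun s => u s - v s) t z < r := by
  have h1 := hu (a + (r - (a - b)) / 2) (by linarith)
  have h2 := ((hasDerivAt_iff_tendsto_slope.1 hv).mono_left
    (nhdsWithin_mono t fun z hz => (ne_of_gt hz : z ≠ t))).eventually
    (lt_mem_nhds (show b - (r - (a - b)) / 2 < b by linarith))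
  filter_upwards [h1, h2] with z h1 h2
  have : slope (fun s => u s - v s) t z = slope u t z - slope v t z := by
    simp only [slope_def_field]; ring
  rw [this]; linarith

/-- A solution of the system truncated from below by a subsolution `w` stays above `w`. -/
lemma IsSubsolution.le_of_hasDerivAt (hW : Wazewski g) (hw : IsSubsolution g w) {T τ : ℝ}
    (hT : 0 ≤ T) {x : ℝ → Fin m → ℝ} (h0 : w T ≤ x T)
    (hx : ∀ t ∈ Icc T (T + τ), HasDerivAt x (g (w t ⊔ x t)) t) :
    ∀ t ∈ Icc T (T + τ), w t ≤ x t := by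
  intro t₁ ht₁ i
  have hxi : ∀ t ∈ Icc T (T + τ), HasDerivAt (fun s => x s i) (g (w t ⊔ x t) i) t := fun t ht =>
    hasDerivAt_pi.1 (hx t ht) i
  refine le_of_forall_pos_le_add fun ε hε => ?_
  -- The barrier ε'(1 + (t - T)) has positive slope and equals ε at t₁.
  set ε' := ε / (1 + (t₁ - T)) with hε'
  have hpos : 0 < 1 + (t₁ - T) := by linarith [ht₁.1]
  have hε'0 : 0 < ε' := by positivity
  have hcont : ContinuousOn (fun s => w s i - x s i) (Icc T (T + τ)) := by
    refine ContinuousOn.sub ?_ fun t ht => (hxi t ht).continuousAt.continuousWithinAt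
    exact (continuousOn_pi.1 hw.continuousOn i).mono fun t ht => hT.trans ht.1
  have hB : ∀ t, HasDerivAt (fun s : ℝ => ε' * (1 + (s - T))) ε' t := fun t => by
    simpa using (((hasDerivAt_id t).sub_const T).const_add 1).const_mul ε'
  have key := image_le_of_liminf_slope_right_lt_deriv_boundary
    (f := fun s => w s i - x s i) (f' := fun t => g (w t) i - g (w t ⊔ x t) i) hcont
    (fun t ht r hr => (slope_sub_lt_of_hasDerivAt (hw.slope_lt t (hT.trans ht.1) i)
      (hxi t ⟨ht.1, ht.2.le⟩) hr).frequently)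
    (B := fun s => ε' * (1 + (s - T))) (B' := fun _ => ε')
    (by have := h0 i; simp; linarith) hB ?_ ht₁
  · have : ε' * (1 + (t₁ - T)) = ε := by rw [hε']; field_simp
    linarith
  -- Where wᵢ - xᵢ meets the barrier, xᵢ < wᵢ, so w and w ⊔ x share their i-th component. The
  -- Ważewski condition gives g(w)ᵢ ≤ g(w ⊔ x)ᵢ, and the slope of the difference is at most 0 < ε'.
  · intro t ht heq
    have h1 : 0 < ε' * (1 + (t - T)) := mul_pos hε'0 (by linarith [ht.1])
    have h2 : x t i < w t i := by linarith
    have hwc := hw.mem_cone t (hT.trans ht.1)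
    have h3 : g (w t) i ≤ g (w t ⊔ x t) i := by
      refine hW i _ hwc _ (fun j => (hwc j).trans ?_) le_sup_left ?_
      · exact le_sup_left (a := w t j) (b := x t j)
      · exact (sup_eq_left.2 h2.le).symm
    linarith

/-- Peano's theorem is applied to g(w ⊔ (x ⊓ b)), bounded because time is clamped to [T, T + 1]. The
truncation from above is inactive for a short time, the one from below by
`IsSubsolution.le_of_hasDerivAt`. -/
lemma IsSubsolution.exists_local_solution_ge (hg : ContinuousOn g (cone m)) (hW : Wazewski g)
    (hw : IsSubsolution g w) {T : ℝ} (hT : 0 ≤ T) {η : Fin m → ℝ} (hη : w T ≤ η) :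
    ∃ τ : ℝ, 0 < τ ∧ ∃ x : ℝ → Fin m → ℝ, x T = η ∧
      ∀ t ∈ Icc T (T + τ), w t ≤ x t ∧ HasDerivAt x (g (x t)) t := by
  let b : Fin m → ℝ := η + 1
  let p : ℝ → ℝ := fun s => T + max 0 (min s 1)
  have hp : Continuous p := by fun_prop
  have hp0 : ∀ s, 0 ≤ p s := fun s => add_nonneg hT (le_max_left _ _)
  have hp1 : ∀ s, p s ∈ Icc T (T + 1) := fun s =>
    ⟨by simp [p], by simp [p]⟩
  have hwp : Continuous fun s => w (p s) := hw.continuousOn.comp_continuous hp hp0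
  let z : ℝ → (Fin m → ℝ) → Fin m → ℝ := fun s x => w (p s) ⊔ (x ⊓ b)
  have hz : Continuous fun q : ℝ × (Fin m → ℝ) => z q.1 q.2 := by
    refine continuous_pi fun i => ?_
    exact ((continuous_apply i).comp (hwp.comp continuous_fst)).sup
      (((continuous_apply i).comp continuous_snd).inf continuous_const)
  have hzcone : ∀ s x, z s x ∈ cone m := fun s x i =>
    (hw.mem_cone _ (hp0 s) i).trans (le_sup_left (a := w (p s) i) (b := (x ⊓ b) i))
  obtain ⟨R, hR⟩ := ((isCompact_Icc (a := T) (b := T + 1)).image_of_continuousOn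
    (hw.continuousOn.mono fun t ht => hT.trans ht.1)).isBounded.exists_norm_le
  have hzball : ∀ s x, z s x ∈ Metric.closedBall (0 : Fin m → ℝ) (max R ‖b‖) ∩ cone m := by
    intro s x
    refine ⟨?_, hzcone s x⟩
    rw [mem_closedBall_zero_iff, pi_norm_le_iff_of_nonneg ((norm_nonneg b).trans (le_max_right _ _))]
    intro i
    rw [Real.norm_of_nonneg (hzcone s x i)]
    have h1 : w (p s) i ≤ R := (le_abs_self _).trans
      ((norm_le_pi_norm (w (p s)) i).trans (hR _ (mem_image_of_mem w (hp1 s))))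
    have h2 : (x ⊓ b) i ≤ ‖b‖ := (inf_le_right (a := x i) (b := b i)).trans
      ((le_abs_self _).trans (norm_le_pi_norm b i))
    exact sup_le (h1.trans (le_max_left _ _)) (h2.trans (le_max_right _ _))
  obtain ⟨M, hM⟩ := (((isCompact_closedBall (0 : Fin m → ℝ) (max R ‖b‖)).inter_right
    isClosed_cone).image_of_continuousOn (hg.mono inter_subset_right)).isBounded.exists_norm_le
  have hGM : ∀ s x, ‖g (z s x)‖ ≤ M := fun s x => hM _ (mem_image_of_mem g (hzball s x))
  have hM0 : 0 ≤ M := (norm_nonneg _).trans (hGM 0 0)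
  have hG : Continuous fun q : ℝ × (Fin m → ℝ) => g (z q.1 q.2) :=
    hg.comp_continuous hz fun q => hzcone _ _
  obtain ⟨y, hy, hyeq⟩ := exists_integral_eq_of_continuous (G := fun s x => g (z s x)) hG hGM η
    one_pos
  have hGy : Continuous fun s => g (z s (y s)) := hG.comp (continuous_id.prodMk hy)
  let X : ℝ → Fin m → ℝ := fun t => η + ∫ s in (0 : ℝ)..(t - T), g (z s (y s))
  have hXd : ∀ t, HasDerivAt X (g (z (t - T) (y (t - T)))) t := fun t => by
    have h1 := (hGy.integral_hasStrictDerivAt 0 (t - T)).hasDerivAt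
    exact (HasDerivAt.comp_sub_const t T h1).const_add η
  -- In this time x moves by at most M/(M + 1) ≤ 1 and so stays below b = η + 1; the length is at
  -- most 1, so the clamp of time is inactive too.
  refine ⟨1 / (M + 1), by positivity, X, by simp [X], ?_⟩
  have hτ1 : 1 / (M + 1) ≤ 1 := by rw [div_le_one (by positivity)]; linarith
  have hXz : ∀ t ∈ Icc T (T + 1 / (M + 1)), z (t - T) (y (t - T)) = w t ⊔ X t := by
    intro t ht
    have ht1 : t - T ∈ Icc (0 : ℝ) 1 := ⟨by linarith [ht.1], by linarith [ht.2]⟩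
    have hyX : y (t - T) = X t := hyeq _ ht1
    have hpt : p (t - T) = t := by
      simp only [p]
      rw [min_eq_left ht1.2, max_eq_right ht1.1]; ring
    have hXb : X t ≤ b := by
      intro i
      have h1 : ‖∫ s in (0 : ℝ)..(t - T), g (z s (y s))‖ ≤ M * |t - T - 0| :=
        intervalIntegral.norm_integral_le_of_norm_le_const fun s _ => hGM s _
      have h2 : M * |t - T - 0| ≤ 1 := by
        rw [sub_zero, abs_of_nonneg ht1.1]
        calc M * (t - T) ≤ M * (1 / (M + 1)) := by gcongr; linarith [ht.2]
          _ ≤ 1 := by rw [mul_one_div, div_le_one (by positivity)]; linarith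
      have h3 := (le_abs_self _).trans ((norm_le_pi_norm
        (∫ s in (0 : ℝ)..(t - T), g (z s (y s))) i).trans (h1.trans h2))
      simp only [X, b, Pi.add_apply, Pi.one_apply]
      linarith
    simp only [z, hpt, hyX]
    rw [inf_eq_left.2 hXb]
  have hXd' : ∀ t ∈ Icc T (T + 1 / (M + 1)), HasDerivAt X (g (w t ⊔ X t)) t := fun t ht => by
    rw [← hXz t ht]; exact hXd t
  have hle := hw.le_of_hasDerivAt hW hT (x := X) (by simpa [X] using hη) hXd'
  intro t ht
  refine ⟨hle t ht, ?_⟩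
  have := hXd' t ht
  rwa [sup_eq_right.2 (hle t ht)] at this

/-- A solution that stays above `w`, on an interval `[0, T)` or `[0, ∞)`. -/
structure PartialSolution (g : (Fin m → ℝ) → Fin m → ℝ) (w : ℝ → Fin m → ℝ) (η : Fin m → ℝ) where
  /-- the interval of existence -/
  dom : Set ℝ
  /-- the solution -/
  sol : ℝ → Fin m → ℝ
  nonneg : ∀ t ∈ dom, 0 ≤ t
  zero_mem : 0 ∈ dom
  down : ∀ t ∈ dom, ∀ s, 0 ≤ s → s ≤ t → s ∈ dom
  exists_gt : ∀ t ∈ dom, ∃ t' ∈ dom, t < t'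
  sol_zero : sol 0 = η
  ge : ∀ t ∈ dom, w t ≤ sol t
  deriv : ∀ t ∈ dom, HasDerivWithinAt sol (g (sol t)) (Ici 0) t

namespace PartialSolution

variable {η : Fin m → ℝ}

/-- `a.Extends b`: the partial solution `b` extends `a`. -/
def Extends (a b : PartialSolution g w η) : Prop := a.dom ⊆ b.dom ∧ EqOn a.sol b.sol a.dom

lemma dom_mem_nhdsWithin (a : PartialSolution g w η) {t : ℝ} (ht : t ∈ a.dom) :
    a.dom ∈ 𝓝[Ici 0] t := by
  obtain ⟨t', ht', htt'⟩ := a.exists_gt t ht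
  filter_upwards [self_mem_nhdsWithin, nhdsWithin_le_nhds (gt_mem_nhds htt')] with s hs hs'
  exact a.down t' ht' s hs hs'.le

/-- The members of a chain agree on common times and glue to a function on the union. Each domain is
relatively open in [0, ∞), so derivatives are inherited. The given a₀ serves the empty chain. -/
lemma exists_extends_of_isChain (a₀ : PartialSolution g w η) {c : Set (PartialSolution g w η)}
    (hc : IsChain Extends c) : ∃ b, ∀ a ∈ c, a.Extends b := by
  classical
  rcases c.eq_empty_or_nonempty with rfl | hne
  · exact ⟨a₀, by simp⟩
  have hagree : ∀ a ∈ c, ∀ b ∈ c, ∀ t, t ∈ a.dom → t ∈ b.dom → a.sol t = b.sol t := by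
    intro a ha b hb t hta htb
    rcases eq_or_ne a b with rfl | hab
    · rfl
    rcases hc ha hb hab with h | h
    · exact h.2 hta
    · exact (h.2 htb).symm
  let x : ℝ → Fin m → ℝ := fun t =>
    if h : ∃ a ∈ c, t ∈ a.dom then h.choose.sol t else 0
  have hx : ∀ a ∈ c, ∀ t ∈ a.dom, x t = a.sol t := by
    intro a ha t ht
    have h : ∃ a ∈ c, t ∈ a.dom := ⟨a, ha, ht⟩
    simp only [x, dif_pos h]
    exact hagree _ h.choose_spec.1 a ha t h.choose_spec.2 ht
  obtain ⟨a₁, ha₁⟩ := hne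
  refine ⟨⟨⋃ a ∈ c, a.dom, x, ?_, ?_, ?_, ?_, ?_, ?_, ?_⟩, fun a ha =>
    ⟨subset_biUnion_of_mem (u := fun a : PartialSolution g w η => a.dom) ha,
      fun t ht => (hx a ha t ht).symm⟩⟩
  · intro t ht
    obtain ⟨a, -, hta⟩ := mem_iUnion₂.1 ht
    exact a.nonneg t hta
  · exact mem_iUnion₂.2 ⟨a₁, ha₁, a₁.zero_mem⟩
  · intro t ht s hs hst
    obtain ⟨a, ha, hta⟩ := mem_iUnion₂.1 ht
    exact mem_iUnion₂.2 ⟨a, ha, a.down t hta s hs hst⟩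
  · intro t ht
    obtain ⟨a, ha, hta⟩ := mem_iUnion₂.1 ht
    obtain ⟨t', ht', htt'⟩ := a.exists_gt t hta
    exact ⟨t', mem_iUnion₂.2 ⟨a, ha, ht'⟩, htt'⟩
  · rw [hx a₁ ha₁ 0 a₁.zero_mem, a₁.sol_zero]
  · intro t ht
    obtain ⟨a, ha, hta⟩ := mem_iUnion₂.1 ht
    rw [hx a ha t hta]
    exact a.ge t hta
  · intro t ht
    obtain ⟨a, ha, hta⟩ := mem_iUnion₂.1 ht
    rw [hx a ha t hta]
    refine (a.deriv t hta).congr_of_eventuallyEq ?_ (hx a ha t hta)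
    filter_upwards [a.dom_mem_nhdsWithin hta] with s hs using hx a ha s hs

/-- The continuation ζ need not stay above w after T. It supplies only the value and the left
derivative at T, from where a local solution above w is started. -/
lemma exists_extends_dom_eq_Ico (hg : ContinuousOn g (cone m)) (hW : Wazewski g)
    (hw : IsSubsolution g w) (a : PartialSolution g w η) {T : ℝ} (hT : 0 < T)
    (hdom : a.dom = Ico 0 T) {ζ : ℝ → Fin m → ℝ} (hζ : IsSolutionOn g (Ici 0) ζ)
    (hζa : EqOn ζ a.sol (Ico 0 T)) : ∃ b : PartialSolution g w η, a.Extends b ∧ T ∈ b.dom := by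
  have hwζ : w T ≤ ζ T := by
    have hne : (𝓝[Ico 0 T] T).NeBot := by
      rw [← mem_closure_iff_nhdsWithin_neBot, closure_Ico hT.ne]
      exact right_mem_Icc.2 hT.le
    have h1 := ((hw.continuousOn T hT.le).mono
      (Ico_subset_Ici_self : Ico 0 T ⊆ Ici 0)).tendsto
    have h2 := ((hζ T hT.le).2.continuousWithinAt.mono
      (Ico_subset_Ici_self : Ico 0 T ⊆ Ici 0)).tendsto
    refine le_of_tendsto_of_tendsto h1 h2 ?_
    filter_upwards [self_mem_nhdsWithin] with t ht
    rw [hζa ht]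
    exact a.ge t (hdom ▸ ht)
  obtain ⟨τ, hτ, x, hxT, hx⟩ := hw.exists_local_solution_ge hg hW hT.le hwζ
  let y : ℝ → Fin m → ℝ := fun t => if t < T then a.sol t else x t
  have hy1 : ∀ {t}, t < T → y t = a.sol t := fun h => if_pos h
  have hy2 : ∀ {t}, T ≤ t → y t = x t := fun h => if_neg h.not_gt
  have hmem : ∀ {t}, 0 ≤ t → t < T → t ∈ a.dom := fun h h' => hdom ▸ ⟨h, h'⟩
  refine ⟨⟨Ico 0 (T + τ), y, fun t ht => ht.1, ⟨le_rfl, by positivity⟩, ?_, ?_, ?_, ?_, ?_⟩,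
    ⟨?_, ?_⟩, ⟨hT.le, by linarith⟩⟩
  · exact fun t ht s hs hst => ⟨hs, hst.trans_lt ht.2⟩
  · intro t ht
    obtain ⟨t', h1, h2⟩ := exists_between ht.2
    exact ⟨t', ⟨ht.1.trans h1.le, h2⟩, h1⟩
  · rw [hy1 hT, a.sol_zero]
  · intro t ht
    rcases lt_or_ge t T with h | h
    · rw [hy1 h]; exact a.ge t (hmem ht.1 h)
    · rw [hy2 h]; exact (hx t ⟨h, ht.2.le⟩).1
  · intro t ht
    rcases lt_trichotomy t T with h | rfl | h
    · rw [hy1 h]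
      refine (a.deriv t (hmem ht.1 h)).congr_of_eventuallyEq ?_ (hy1 h)
      filter_upwards [nhdsWithin_le_nhds (gt_mem_nhds h)] with s hs using hy1 hs
    · have h1 : HasDerivWithinAt y (g (y t)) (Icc 0 t) t := by
        rw [hy2 le_rfl, hxT]
        refine ((hζ t hT.le).2.mono Icc_subset_Ici_self).congr (fun s hs => ?_)
          (by rw [hy2 le_rfl, hxT])
        rcases hs.2.eq_or_lt with rfl | h
        · rw [hy2 le_rfl, hxT]
        · rw [hy1 h, hζa ⟨hs.1, h⟩]
      have h2 : HasDerivWithinAt y (g (y t)) (Ici t) t := by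
        rw [hy2 le_rfl]
        exact (hx t ⟨le_rfl, by linarith⟩).2.hasDerivWithinAt.congr (fun s hs => hy2 hs)
          (hy2 le_rfl)
      have h3 := h1.union h2
      rwa [Icc_union_Ici_eq_Ici hT.le] at h3
    · rw [hy2 h.le]
      refine ((hx t ⟨h.le, ht.2.le⟩).2.hasDerivWithinAt).congr_of_eventuallyEq ?_ (hy2 h.le)
      filter_upwards [nhdsWithin_le_nhds (lt_mem_nhds h)] with s hs using hy2 (le_of_lt hs)
  · exact hdom.le.trans (Ico_subset_Ico_right (by linarith))
  · intro t ht
    rw [hdom] at ht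
    exact (hy1 ht.2).symm

end PartialSolution

/-- **Comparison theorem.** If every solution on a bounded interval with initial value `η ≥ w(0)`
extends to `[0, ∞)`, then some solution on `[0, ∞)` with initial value `η` dominates `w`. -/
theorem IsSubsolution.exists_solution_ge (hg : ContinuousOn g (cone m)) (hW : Wazewski g)
    (hw : IsSubsolution g w) {η : Fin m → ℝ} (hη : w 0 ≤ η)
    (hext : ∀ (T : ℝ) (ξ : ℝ → Fin m → ℝ), 0 < T → IsSolutionOn g (Ico 0 T) ξ → ξ 0 = η →
      ∃ ζ : ℝ → Fin m → ℝ, IsSolutionOn g (Ici 0) ζ ∧ EqOn ζ ξ (Ico 0 T)) :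
    ∃ x : ℝ → Fin m → ℝ, x 0 = η ∧ IsSolutionOn g (Ici 0) x ∧ ∀ t, 0 ≤ t → w t ≤ x t := by
  obtain ⟨τ, hτ, x₀, hx₀, hx⟩ := hw.exists_local_solution_ge hg hW le_rfl hη
  rw [zero_add] at hx
  let a₀ : PartialSolution g w η :=
    { dom := Ico 0 τ
      sol := x₀
      nonneg := fun t ht => ht.1
      zero_mem := ⟨le_rfl, hτ⟩
      down := fun t ht s hs hst => ⟨hs, hst.trans_lt ht.2⟩
      exists_gt := fun t ht => by
        obtain ⟨t', h1, h2⟩ := exists_between ht.2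
        exact ⟨t', ⟨ht.1.trans h1.le, h2⟩, h1⟩
      sol_zero := hx₀
      ge := fun t ht => (hx t ⟨ht.1, ht.2.le⟩).1
      deriv := fun t ht => (hx t ⟨ht.1, ht.2.le⟩).2.hasDerivWithinAt }
  -- A maximal partial solution that misses some t ≥ 0 has domain [0, T), T its supremum, and `hext`
  -- allows it to be continued past T.
  obtain ⟨a, ha⟩ := exists_maximal_of_chains_bounded (r := PartialSolution.Extends)
    (fun c hc => PartialSolution.exists_extends_of_isChain a₀ hc)
    (fun {a b c} hab hbc => ⟨hab.1.trans hbc.1, fun t ht => (hab.2 ht).trans (hbc.2 (hab.1 ht))⟩)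
  have hcone : ∀ t ∈ a.dom, a.sol t ∈ cone m := fun t ht i =>
    (hw.mem_cone t (a.nonneg t ht) i).trans (a.ge t ht i)
  have hall : ∀ t, 0 ≤ t → t ∈ a.dom := by
    intro t ht
    by_contra hta
    have hlt : ∀ s ∈ a.dom, s < t := fun s hs => by
      by_contra! h
      exact hta (a.down s hs t ht h)
    have hbdd : BddAbove a.dom := ⟨t, fun s hs => (hlt s hs).le⟩
    set T := sSup a.dom
    have hltT : ∀ s ∈ a.dom, s < T := fun s hs => by
      obtain ⟨s', hs', hss'⟩ := a.exists_gt s hs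
      exact hss'.trans_le (le_csSup hbdd hs')
    have hT : 0 < T := hltT 0 a.zero_mem
    have hdom : a.dom = Ico 0 T := by
      ext s
      refine ⟨fun hs => ⟨a.nonneg s hs, hltT s hs⟩, fun hs => ?_⟩
      obtain ⟨s', hs', hss'⟩ := exists_lt_of_lt_csSup ⟨0, a.zero_mem⟩ hs.2
      exact a.down s' hs' s hs.1 hss'.le
    obtain ⟨ζ, hζ, hζa⟩ := hext T a.sol hT (fun s hs => ⟨hcone s (hdom ▸ hs),
      (a.deriv s (hdom ▸ hs)).mono Ico_subset_Ici_self⟩) a.sol_zero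
    obtain ⟨b, hab, hTb⟩ := a.exists_extends_dom_eq_Ico hg hW hw hT hdom hζ hζa
    exact lt_irrefl T (hltT T ((ha b hab).1 hTb))
  exact ⟨a.sol, a.sol_zero, fun t ht => ⟨hcone t (hall t ht), a.deriv t (hall t ht)⟩,
    fun t ht => a.ge t (hall t ht)⟩

end Comparison

/-! ### Transfer of stability from the comparison system to the semiflow -/

section Stability

lemma continuous_initSeg {k : ℕ} (i : Fin (k + 1)) :
    Continuous fun ξ : Fin (k + 1) → ℝ => initSeg ξ i :=
  continuous_pi fun _ => continuous_apply _

lemma mapsTo_initSeg {k : ℕ} (i : Fin (k + 1)) :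
    MapsTo (fun ξ : Fin (k + 1) → ℝ => initSeg ξ i) (cone (k + 1)) (cone ((i : ℕ) + 1)) :=
  fun _ hξ _ => hξ _

lemma continuousOn_compRHS {k : ℕ} {a : ℝ} {φ : ℝ → ℝ} (hφ : ContinuousOn φ (Ici 0))
    {f : (i : ℕ) → (Fin (i + 1) → ℝ) → ℝ}
    (hf : ∀ i : ℕ, 1 ≤ i → i ≤ k → ContinuousOn (f i) (cone (i + 1)))
    {ψ : (i : ℕ) → (Fin i → ℝ) → ℝ}
    (hψ : ∀ i : ℕ, 1 ≤ i → i ≤ k → ContinuousOn (ψ i) (cone i)) :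
    ContinuousOn (compRHS k a φ f ψ) (cone (k + 1)) := by
  refine continuousOn_pi.2 fun i => ?_
  unfold compRHS
  refine ContinuousOn.add ?_ ?_
  · by_cases hi : i = 0
    · simp only [if_pos hi]
      have h0 : ContinuousOn (fun ξ : Fin (k + 1) → ℝ => ξ 0) (cone (k + 1)) :=
        (continuous_apply 0).continuousOn
      exact (continuousOn_const.mul (hφ.comp h0 fun ξ hξ => hξ 0)).mul h0
    · simp only [if_neg hi]
      exact (hf i (Nat.one_le_iff_ne_zero.2 fun h => hi (Fin.ext h))
        (Nat.lt_succ_iff.1 i.2)).comp (continuous_initSeg i).continuousOn (mapsTo_initSeg i)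
  · by_cases hi : (i : ℕ) < k
    · simp only [dif_pos hi]
      exact ((hψ ((i : ℕ) + 1) (Nat.le_add_left 1 _) hi).comp (continuous_initSeg i).continuousOn
        (mapsTo_initSeg i)).mul (continuous_apply _).continuousOn
    · simp only [dif_neg hi]
      exact continuousOn_const

lemma compRHS_zero {k : ℕ} (hk : 1 ≤ k) (a : ℝ) (φ : ℝ → ℝ) (f : (i : ℕ) → (Fin (i + 1) → ℝ) → ℝ)
    (ψ : (i : ℕ) → (Fin i → ℝ) → ℝ) (ξ : Fin (k + 1) → ℝ) :
    compRHS k a φ f ψ ξ 0 =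
      a * φ (ξ 0) * ξ 0 + ψ 1 (fun _ => ξ 0) * ξ ⟨1, Nat.succ_lt_succ hk⟩ := by
  have hseg : initSeg ξ 0 = fun _ => ξ 0 := by
    funext j
    have hj : (j : ℕ) = 0 := Nat.lt_one_iff.1 j.2
    exact congrArg ξ (Fin.ext hj)
  have h0 : ((0 : Fin (k + 1)) : ℕ) < k := hk
  unfold compRHS
  rw [if_pos rfl, dif_pos h0, hseg]
  rfl

/-- Since 𝔉ᶻ(u) = 𝔉ᶻ⁻ᵗ(𝔉ᵗ(u)), slopes at time t along the orbit of u are slopes at time 0 along the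
orbit of 𝔉ᵗ(u). -/
lemma IsGlobalSemiflowOn.eventually_slope_lt {X : Type*} [MetricSpace X] {G : Set X}
    {Φ : ℝ → X → X} (hΦ : IsGlobalSemiflowOn G Φ) {u : X} (hu : u ∈ G) (v : X → ℝ) {t r : ℝ}
    (ht : 0 ≤ t) (h : ∀ᶠ h in 𝓝[>] (0 : ℝ), slope (fun h => v (Φ h (Φ t u))) 0 h < r) :
    ∀ᶠ z in 𝓝[>] t, slope (fun s => v (Φ s u)) t z < r := by
  have hlim : Tendsto (fun z => z - t) (𝓝[>] t) (𝓝[>] 0) := by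
    refine tendsto_nhdsWithin_iff.2 ⟨?_, ?_⟩
    · have : Tendsto (fun z => z - t) (𝓝 t) (𝓝 (t - t)) := (continuous_sub_right t).tendsto t
      rw [sub_self] at this
      exact this.mono_left nhdsWithin_le_nhds
    · filter_upwards [self_mem_nhdsWithin] with z hz using sub_pos.2 (mem_Ioi.1 hz)
  filter_upwards [hlim.eventually h, self_mem_nhdsWithin] with z hz htz
  have htz : t < z := htz
  rw [slope_def_field, hΦ.add _ _ (sub_nonneg.2 htz.le) ht u hu,
    hΦ.zero _ (hΦ.mapsTo t ht u hu), sub_add_cancel, sub_zero] at hz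
  rwa [slope_def_field]

lemma DifferentiableAlongOrbits.eventually_slope_lt {X : Type*} {G : Set X} {Φ : ℝ → X → X}
    {W : X → ℝ} (hW : DifferentiableAlongOrbits G Φ W) {u : X} (hu : u ∈ G) {r : ℝ}
    (hr : orbitDeriv Φ W u < r) : ∀ᶠ h in 𝓝[>] (0 : ℝ), slope (fun h => W (Φ h u)) 0 h < r :=
  ((hasDerivWithinAt_iff_tendsto_slope' self_notMem_Ioi).1
    (hW u hu).2.hasDerivWithinAt.Ioi_of_Ici).eventually (gt_mem_nhds hr)

lemma lt_of_maxMeasure_lt {X : Type*} {k : ℕ} {W : ℕ → X → ℝ} {u : X} {δ : ℝ}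
    (h : maxMeasure k W u < δ) (i : Fin (k + 1)) : W i u < δ :=
  (Finset.sup'_lt_iff _).1 h i (Finset.mem_univ i)

/-- If `V, W₁, …, W_k` form a subsolution along the orbit of `u`, then `V` is dominated by the first
component of a solution of the comparison system with small positive initial values. -/
lemma exists_dominating_solution {X : Type*} {k : ℕ} {W : ℕ → X → ℝ} {Φ : ℝ → X → X} {u : X}
    {g : (Fin (k + 1) → ℝ) → Fin (k + 1) → ℝ} (hg : ContinuousOn g (cone (k + 1)))
    (hWaz : Wazewski g) (hΦ0 : Φ 0 u = u)
    (hsub : IsSubsolution g fun t (i : Fin (k + 1)) => W i (Φ t u)) {δ δ' : ℝ} (hδ' : 0 < δ')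
    (hδ : δ' ≤ δ)
    (hext : ∀ (T : ℝ) (ξ : ℝ → Fin (k + 1) → ℝ), 0 < T → IsSolutionOn g (Ico 0 T) ξ →
      (∀ i, 0 < ξ 0 i) → ‖ξ 0‖ < δ →
        ∃ η : ℝ → Fin (k + 1) → ℝ, IsSolutionOn g (Ici 0) η ∧ EqOn η ξ (Ico 0 T))
    (hu : maxMeasure k W u < δ') :
    ∃ ξ : ℝ → Fin (k + 1) → ℝ, IsSolutionOn g (Ici 0) ξ ∧ (∀ i, 0 < ξ 0 i) ∧ ‖ξ 0‖ < δ' ∧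
      ∀ t, 0 ≤ t → W 0 (Φ t u) ≤ ξ t 0 := by
  -- The constant vector c is the initial value. It is taken above 0 as well, since some Wᵢ[u] may
  -- vanish while solutions must start with positive components.
  obtain ⟨c, hc, hcδ⟩ := exists_between (max_lt hu hδ')
  have hc0 : 0 < c := (le_max_right _ _).trans_lt hc
  have hcu : maxMeasure k W u < c := (le_max_left _ _).trans_lt hc
  have hnorm : ‖(fun _ => c : Fin (k + 1) → ℝ)‖ = c := by
    rw [pi_norm_const, Real.norm_of_nonneg hc0.le]
  obtain ⟨ξ, hξ0, hξ, hle⟩ := hsub.exists_solution_ge hg hWaz (η := fun _ => c)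
    (fun i => by simpa only [hΦ0] using (lt_of_maxMeasure_lt hcu i).le)
    (fun T ξ hT hξ h0 => hext T ξ hT hξ (fun i => by rw [h0]; exact hc0)
      (by rw [h0, hnorm]; exact hcδ.trans_le hδ))
  exact ⟨ξ, hξ, fun i => by rw [hξ0]; exact hc0, by rw [hξ0, hnorm]; exact hcδ,
    fun t ht => hle t ht 0⟩

end Stability

end ConvSemiflow

theorem theorem4p4 (n k : ℕ) (hn : 1 ≤ n) (hk : 1 ≤ k)
    -- the data of the semiflow
    (A : EuclideanSpace ℝ (Fin n) →L[ℝ] EuclideanSpace ℝ (Fin n))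
    (φ : ℝ → ℝ) (hφ_nonneg : ∀ s : ℝ, 0 ≤ s → 0 ≤ φ s) (hφ_lip : LocallyLipschitzOn (Ici 0) φ)
    (F : ℝ → Conv n → Conv n)
    (hF_lip : LocallyLipschitzOn (Ici (0 : ℝ) ×ˢ (univ : Set (Conv n))) (fun q => F q.1 q.2))
    -- the global semiflow of the integral equation on the closed set G, with the fixed point {0}
    (G : Set (Conv n)) (hG : IsClosed G) (hG0 : (0 : Conv n) ∈ G)
    (Φ : ℝ → Conv n → Conv n) (hΦ : IsGlobalSemiflowOn G Φ)
    (hΦ_eq : ∀ u ∈ G, SolvesIntegralEq A φ F u (fun t => Φ t u))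
    (hΦ0 : ∀ t : ℝ, 0 ≤ t → Φ t 0 = 0)
    -- the functionals W_0 = V, W_1, ..., W_k and the functions f_1, ..., f_k, psi_1, ..., psi_k
    (W : ℕ → Conv n → ℝ) (hW0 : ∀ u, W 0 u = vol u)
    (hW_nonneg : ∀ i : ℕ, 1 ≤ i → i ≤ k → ∀ u ∈ G, 0 ≤ W i u)
    (hW_diff : ∀ i : ℕ, 1 ≤ i → i ≤ k → DifferentiableAlongOrbits G Φ (W i))
    (f : (i : ℕ) → (Fin (i + 1) → ℝ) → ℝ)
    (hf : ∀ i : ℕ, 1 ≤ i → i ≤ k → ContinuousOn (f i) (cone (i + 1)))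
    (ψ : (i : ℕ) → (Fin i → ℝ) → ℝ)
    (hψ : ∀ i : ℕ, 1 ≤ i → i ≤ k → ContinuousOn (ψ i) (cone i))
    -- the differential inequalities
    (hineq₀ : ∀ u ∈ G, n * mixedVol 1 u (F (vol u) u) ≤ ψ 1 (fun _ => vol u) * W 1 u)
    (hineq : ∀ i : Fin (k + 1), i ≠ 0 → ∀ u ∈ G,
      orbitDeriv Φ (W i) u ≤
        compRHS k (LinearMap.trace ℝ _ A.toLinearMap) φ f ψ (fun j => W j u) i)
    -- the comparison system
    (hWaz : Wazewski (compRHS k (LinearMap.trace ℝ _ A.toLinearMap) φ f ψ))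
    (hzero : compRHS k (LinearMap.trace ℝ _ A.toLinearMap) φ f ψ 0 = 0) :
    (XiZeroStable (compRHS k (LinearMap.trace ℝ _ A.toLinearMap) φ f ψ) →
      StableInMeasures G Φ (maxMeasure k W) vol) ∧
    (AsympXiZeroStable (compRHS k (LinearMap.trace ℝ _ A.toLinearMap) φ f ψ) →
      AsympStableInMeasures G Φ (maxMeasure k W) vol) := by
  set a := LinearMap.trace ℝ _ A.toLinearMap with ha
  set g := compRHS k a φ f ψ with hgdef
  have hφ : ContinuousOn φ (Ici 0) := hφ_lip.continuousOn
  have hg : ContinuousOn g (cone (k + 1)) := continuousOn_compRHS hφ hf hψ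
  have hsub : ∀ u ∈ G, IsSubsolution g fun t (i : Fin (k + 1)) => W i (Φ t u) := by
    intro u hu
    refine ⟨continuousOn_pi.2 fun i => ?_, fun t ht i => ?_, fun t ht i r hr => ?_⟩
    · by_cases hi : i = 0
      · subst hi
        simp only [Fin.val_zero, hW0]
        exact continuous_vol.comp_continuousOn (hΦ.continuous_time u hu)
      · exact (hW_diff i (Nat.one_le_iff_ne_zero.2 fun h => hi (Fin.ext h))
          (Nat.lt_succ_iff.1 i.2) u hu).1
    · by_cases hi : i = 0
      · subst hi
        simp only [Fin.val_zero, hW0]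
        exact vol_nonneg _
      · exact hW_nonneg i (Nat.one_le_iff_ne_zero.2 fun h => hi (Fin.ext h))
          (Nat.lt_succ_iff.1 i.2) _ (hΦ.mapsTo t ht u hu)
    · have hv := hΦ.mapsTo t ht u hu
      refine hΦ.eventually_slope_lt hu (W i) ht ?_
      by_cases hi : i = 0
      · subst hi
        simp only [Fin.val_zero, hW0]
        -- The integral equation is restarted at 𝔉ᵗ(u), which lies in G, so only the derivative at
        -- time 0 is needed.
        refine eventually_slope_vol_lt hn hφ hF_lip.continuousOn (hΦ.zero _ hv) (hΦ_eq _ hv) ?_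
        refine lt_of_le_of_lt ?_ hr
        rw [hgdef, compRHS_zero hk]
        simp only [Fin.val_zero, hW0]
        exact add_le_add le_rfl (hineq₀ _ hv)
      · exact (hW_diff i (Nat.one_le_iff_ne_zero.2 fun h => hi (Fin.ext h))
          (Nat.lt_succ_iff.1 i.2)).eventually_slope_lt hv ((hineq i hi _ hv).trans_lt hr)
  have hstable : XiZeroStable g → StableInMeasures G Φ (maxMeasure k W) vol := by
    intro hst ε hε
    obtain ⟨δ, hδ, hext, hlt⟩ := hst ε hε
    refine ⟨δ, hδ, fun u hu huδ t ht => ?_⟩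
    obtain ⟨ξ, hξ, hpos, hnorm, hle⟩ := exists_dominating_solution hg hWaz (hΦ.zero u hu)
      (hsub u hu) hδ le_rfl hext huδ
    rw [← hW0]
    exact (hle t ht).trans_lt (hlt ξ hξ hpos hnorm t ht)
  refine ⟨hstable, fun ⟨hst, ρ, hρ, hlim⟩ => ⟨hstable hst, ?_⟩⟩
  -- Stability at level 1 serves only to extend solutions to [0, ∞); convergence comes from ρ.
  obtain ⟨δ, hδ, hext, -⟩ := hst 1 one_pos
  refine ⟨min δ ρ, lt_min hδ hρ, fun u hu huδ => ?_⟩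
  obtain ⟨ξ, hξ, hpos, hnorm, hle⟩ := exists_dominating_solution hg hWaz (hΦ.zero u hu)
    (hsub u hu) (lt_min hδ hρ) (min_le_left δ ρ) hext huδ
  refine squeeze_zero' (Eventually.of_forall fun t => vol_nonneg _) ?_
    (hlim ξ hξ hpos (hnorm.trans_le (min_le_right δ ρ)))
  filter_upwards [eventually_ge_atTop 0] with t ht
  rw [← hW0]
  exact hle t ht
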